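/- Throughout $\log=\log_2$. Let $d\ge 1$, $0<\beta\le 1$, and for a sequence $Z=(Z_n)_{n\ge1}$ in $[0,1)^d$ let $$\mathrm{Disc}(Z^n)=\sup\Big\{\big|\#\{i\le n: Z_i\in R\}-n|R|\big| \;:\; R=\prod_{j=1}^d[a_j,b_j),\ 0\le a_j<b_j\le 1\Big\},$$ where $|R|$ is the volume of $R$. *Thinning.* A two-thinning strategy is a sequence of measurable functions $f_n:([0,1)^d)^{n-1}\times[0,1)^d\to[0,1]$, $n\ge1$; it is a $(1+\beta)$-thinning strategy if, for every $n$ and $z$, $f_n(z,x)\ge 1-\beta$ for almost every $x$. Let $X_1,X_2,\dots$ be i.i.d. uniform on $[0,1)^d$ and let $U_1,U_2,\dots$ be i.i.d. uniform on $[0,1]$, independent of the $X_i$. The sequence $Z$ produced by the strategy is defined inductively by $$\chi_n=\mathbf 1\big\{U_n>f_n\big((Z_1,\dots,Z_{n-1}),X_{n+\sum_{i<n}\chi_i}\big)\big\},\qquad Z_n=X_{n+\sum_{i\le n}\chi_i}.$$ *Haar functions.* A dyadic interval is $I=[a2^{-\ell},(a+1)2^{-\ell})$ with $a,\ell\in\mathbb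 Z$. If its left half is contained in $[0,1)$, let $H_I:[0,1)\to\{-1,0,1\}$ be $1$ on the left half of $I$, $-1$ on the right half of $I$ and $0$ elsewhere; the order of $H_I$ is $\ell+1$. A Haar function on $[0,1)^d$ is a product $H(x)=\prod_{j=1}^d H_{I_j}(x_j)$ of such functions, and its order is the sum of the orders of the factors. Let $\mathcal H_1^h$ be the set of Haar functions on $[0,1)^d$ of order between $1$ and $h$, and let $W(h)=\sum_{i=1}^h\binom{i+d-1}{d-1}$. *The Haar strategy.* Given $Z_1,\dots,Z_{n-1}$, put $h=\lfloor\log n\rfloor$ and $$\lambda_n(x)=1+\frac{\beta}{2W(h)}\sum_{H\in\mathcal H_1^h}\mathrm{sgn}\Big(-\sum_{i=1}^{n-1}H(Z_i)\Big)H(x)$$ (with $\lambda_1=1$, and $\mathrm{sgn}(0)=0$). The Haar $(1+\beta)$-thinning strategy is $f_n((Z_1,\dots,Z_{n-1}),x)=\lambda_n(x)-\beta/2$. **Theorem.** The Haar $(1+\beta)$-thinning strategy is a $(1+\beta)$-thinning strategy, and the sequence $Z$ that it produces satisfies, almost surely, $$\limsup_{n\to\infty}\frac{\mathrm{Disc}(Z^n)}{\log^{2d+1}(n)}\le\frac{100(d^2+1)}{\beta}.$$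 -/

import Mathlib

open MeasureTheory ProbabilityTheory Filter

noncomputable section

/-- The half-open unit cube `[0,1)^d`. -/
abbrev UnitCube (d : ℕ) : Type := Fin d → Set.Ico (0 : ℝ) 1

/-- Lebesgue measure on `[0,1)^d`, that is, the uniform distribution. -/
def lebesgueCube (d : ℕ) : Measure (UnitCube d) :=
  Measure.pi fun _ => (volume : Measure ℝ).comap Subtype.val

/-! ### Discrepancy -/

/-- The `R`-discrepancy of a finite family of points with respect to a measure `m`:
the supremum over `A ∈ R` of `|#{i | z i ∈ A} - n * m A|`. -/
def discrepancy {E : Type*} [MeasurableSpace E] (m : Measure E) (R : Set (Set E))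
    {n : ℕ} (z : Fin n → E) : ℝ :=
  sSup ((fun A : Set E => |(∑ i, A.indicator (fun _ => (1 : ℝ)) (z i)) - n * m.real A|) '' R)

/-- The axis-parallel boxes `∏ [a_j, b_j)` with `0 ≤ a_j < b_j ≤ 1`. -/
def boxes (d : ℕ) : Set (Set (UnitCube d)) :=
  {A | ∃ a b : Fin d → ℝ, (∀ j, 0 ≤ a j ∧ a j < b j ∧ b j ≤ 1) ∧
    A = {x | ∀ j, a j ≤ (x j : ℝ) ∧ (x j : ℝ) < b j}}

/-- `Disc (Z^n)`: the box discrepancy of the first `n` points of the sequence `Z`. -/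
def boxDisc {d : ℕ} (Z : ℕ → UnitCube d) (n : ℕ) : ℝ :=
  discrepancy (lebesgueCube d) (boxes d) (fun i : Fin n => Z i)

/-! ### Thinning strategies -/

/-- A family of functions of the points kept so far and of the point on offer. The value
`f k z x` is the probability of keeping `x` when `k` points `z` have already been kept, so that
`f k` is in force for the choice of the `(k + 1)`-st point. -/
abbrev KeepRule (d : ℕ) : Type := (k : ℕ) → (Fin k → UnitCube d) → UnitCube d → ℝ

/-- `(1 + β)`-thinning strategies. -/
structure IsThinningStrategy {d : ℕ} (β : ℝ) (f : KeepRule d) : Prop where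
  measurable : ∀ k, Measurable fun p : (Fin k → UnitCube d) × UnitCube d => f k p.1 p.2
  mem_Icc : ∀ k z x, f k z x ∈ Set.Icc (0 : ℝ) 1
  one_sub_le : ∀ k z, ∀ᵐ x ∂(lebesgueCube d), 1 - β ≤ f k z x

/-- The points kept in the first `k` rounds and the number of points rejected in them, when the
offered points are `x 0, x 1, …` and the external randomness is `u 0, u 1, …`. In a round that
follows `k` kept and `r` rejected points, the point `x (k + r)` is on offer; it is rejected when
`u k > f k z (x (k + r))`, and then the next point `x (k + r + 1)` is kept. -/
def thinningState {d : ℕ} (f : KeepRule d) (x : ℕ → UnitCube d) (u : ℕ → ℝ) :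
    (k : ℕ) → (Fin k → UnitCube d) × ℕ
  | 0 => (Fin.elim0, 0)
  | k + 1 =>
    let s := thinningState f x u k
    let χ : ℕ := if f k s.1 (x (k + s.2)) < u k then 1 else 0
    (Fin.snoc s.1 (x (k + s.2 + χ)), s.2 + χ)

/-- The sequence produced by the strategy `f`; `thinnedSeq f x u k` is its `(k + 1)`-st point. -/
def thinnedSeq {d : ℕ} (f : KeepRule d) (x : ℕ → UnitCube d) (u : ℕ → ℝ) (k : ℕ) : UnitCube d :=
  (thinningState f x u (k + 1)).1 (Fin.last k)

/-! ### Haar functions -/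

/-- The Haar function of order `m` at position `a` on `[0,1)`: it is `1` on the left half and `-1`
on the right half of the dyadic interval `[2a/2^m, (2a+2)/2^m)`, and `0` elsewhere. The dyadic
intervals whose left half lies in `[0,1)` are those with `a < 2^(m-1)` for `m ≥ 1`, and `[0,2)`
(`m = 0`, `a = 0`), which gives the constant function `1`. -/
def haarOne (m a : ℕ) (x : Set.Ico (0 : ℝ) 1) : ℝ :=
  if (x : ℝ) ∈ Set.Ico ((2 * a : ℝ) / 2 ^ m) ((2 * a + 1 : ℝ) / 2 ^ m) then 1
  else if (x : ℝ) ∈ Set.Ico ((2 * a + 1 : ℝ) / 2 ^ m) ((2 * a + 2 : ℝ) / 2 ^ m) then -1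
  else 0

/-- The Haar function on `[0,1)^d` with orders `m` and positions `a` in the `d` coordinates;
its order is `∑ i, m i`. -/
def haar {d : ℕ} (m a : Fin d → ℕ) (x : UnitCube d) : ℝ :=
  ∏ i, haarOne (m i) (a i) (x i)

/-- The order vectors of the Haar functions of order between `1` and `h`. -/
def haarOrders (d h : ℕ) : Finset (Fin d → ℕ) :=
  (Fintype.piFinset fun _ : Fin d => Finset.range (h + 1)).filter
    fun m => 1 ≤ ∑ i, m i ∧ ∑ i, m i ≤ h

/-- The position vectors of the Haar functions with order vector `m`: in each coordinate one
position for order `0`, and `2^(m-1)` positions for order `m ≥ 1`. -/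
def haarPositions {d : ℕ} (m : Fin d → ℕ) : Finset (Fin d → ℕ) :=
  Fintype.piFinset fun i => Finset.range (2 ^ (m i - 1))

/-! ### The Haar strategy -/

/-- `W(s) = ∑_{i=1}^s binom(i+d-1, d-1)`. -/
def haarWeight (d s : ℕ) : ℕ := ∑ i ∈ Finset.Icc 1 s, (i + d - 1).choose (d - 1)

/-- The conditional density of the `n`-th point given the `k` points `z` with counting measure
`ν = ∑ i, δ_{z i}` (used with `n = k + 1`):
`1 + β / (2 W(h)) * ∑_H sgn ⟨ν, -H⟩ H`, where `h = ⌊log₂ n⌋` and `H` runs over the Haar functions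
of order between `1` and `h`. For `h = 0` the sum is empty and the density is `1`. -/
def haarDensity {d : ℕ} (β : ℝ) (n : ℕ) {k : ℕ} (z : Fin k → UnitCube d) (x : UnitCube d) : ℝ :=
  1 + β / (2 * haarWeight d (Nat.log 2 n)) *
    ∑ m ∈ haarOrders d (Nat.log 2 n), ∑ a ∈ haarPositions m,
      Real.sign (∑ i, -haar m a (z i)) * haar m a x

/-- The Haar `(1 + β)`-thinning strategy: the point on offer is kept with probability
`λ - β / 2`, where `λ` is the conditional density above. -/
def haarStrategy (d : ℕ) (β : ℝ) : KeepRule d :=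
  fun k z x => haarDensity β (k + 1) z x - β / 2

end

/-! The strategy gives every Haar sum of controlled order a drift towards zero, and the Haar sums
control all boxes.

Law of a point: an offered uniform point `y` is kept with probability `f y` and otherwise replaced
by a fresh uniform one, so given the past the next point has density `f + (1 - ∫ f)`. For the Haar
strategy `∫ f = 1 - β / 2`, so this is exactly `haarDensity` (`lintegral_keep_or_replace`,
`lintegral_next_point`). For each order vector at most one Haar function is nonzero at a given
point, and there are at most `haarWeight` order vectors; hence the density stays within `β / 2` of
`1`.

Haar sums: let `S_k` be the sum of a Haar function `H` of order `M` over the first `k` points. By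
orthogonality the drift of `S_k` comes from the term of `H` alone. It vanishes while `k + 1 < 2 ^ M`
and afterwards is `-ε sgn(S_k) ∫ H²`, with `ε = β / (2 W)`. With `η` the value of `ε` at the final
time `n`, put `E_k = 𝔼 cosh (η S_k)`. In the first phase `E_k` grows by a factor at most `1 + 2 ^ d
/ 2 ^ M` per step, hence stays below `exp (2 ^ d)`; in the second it satisfies `E_{k+1} ≤ (1 - δ /
7) E_k + δ`, which preserves any bound that is at least `7`. So `E_n ≤ exp (2 ^ d)`
(`lintegral_cosh_le`). Markov's inequality, a union bound over polynomially many Haar functions and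
Borel–Cantelli make all these sums `O(W log n / β)` almost surely (`ae_eventually_haar_le`).

Boxes: a dyadic interval is half its parent plus or minus half a Haar function, so dyadic boxes of
volume at least `2 ^ (-h)` inherit the Haar bound without loss. Binary expansion of the endpoints
splits a box into `O(h ^ d)` of these and remainders covered by dyadic boxes of volume `2 ^ (-h)`,
with `h = ⌊log₂ n⌋` (`abs_signedDisc_box_le`). The factors `log^d` from the boxes, `log^d` from `W`
and `log` from the tail bound multiply to `log^(2d+1)`. -/

open scoped ENNReal

/-! ### Dyadic cells and Haar functions in one coordinate -/

/-- The index of the dyadic interval of length `2 ^ (-l)` that contains `x`. -/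
noncomputable def dyadicCell (l : ℕ) (x : Set.Ico (0 : ℝ) 1) : ℕ := ⌊(x : ℝ) * 2 ^ l⌋₊

lemma dyadicCell_lt (l : ℕ) (x : Set.Ico (0 : ℝ) 1) : dyadicCell l x < 2 ^ l := by
  unfold dyadicCell
  rw [Nat.floor_lt (by have := x.2.1; positivity)]
  push_cast
  have := x.2.2
  have h : (0 : ℝ) < 2 ^ l := by positivity
  nlinarith

lemma dyadicCell_zero (x : Set.Ico (0 : ℝ) 1) : dyadicCell 0 x = 0 := by
  have := dyadicCell_lt 0 x
  simpa using this

lemma floor_mul_two_pow_succ (b : ℝ) (l : ℕ) : ⌊b * 2 ^ l⌋₊ = ⌊b * 2 ^ (l + 1)⌋₊ / 2 := by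
  rw [← Nat.floor_div_ofNat]
  congr 1
  rw [pow_succ]
  field_simp

lemma dyadicCell_succ_div (l : ℕ) (x : Set.Ico (0 : ℝ) 1) :
    dyadicCell (l + 1) x / 2 = dyadicCell l x :=
  (floor_mul_two_pow_succ _ _).symm

lemma dyadicCell_add_div (l j : ℕ) (x : Set.Ico (0 : ℝ) 1) :
    dyadicCell (l + j) x / 2 ^ j = dyadicCell l x := by
  induction j with
  | zero => simp
  | succ j ih =>
    rw [pow_succ', ← Nat.div_div_eq_div_mul, ← add_assoc, dyadicCell_succ_div, ih]

lemma measurable_dyadicCell (l : ℕ) : Measurable (dyadicCell l) :=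
  Nat.measurable_floor.comp (measurable_subtype_coe.mul_const _)

lemma mem_Ico_iff_dyadicCell_eq (l a : ℕ) (x : Set.Ico (0 : ℝ) 1) :
    (x : ℝ) ∈ Set.Ico ((a : ℝ) / 2 ^ l) ((a + 1 : ℝ) / 2 ^ l) ↔ dyadicCell l x = a := by
  unfold dyadicCell
  rw [Nat.floor_eq_iff (by have := x.2.1; positivity), Set.mem_Ico, div_le_iff₀ (by positivity),
    lt_div_iff₀ (by positivity)]

/-- The indicator of the dyadic interval `[a / 2 ^ l, (a + 1) / 2 ^ l)`. -/
noncomputable def dyadicInd (l a : ℕ) (x : Set.Ico (0 : ℝ) 1) : ℝ :=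
  if dyadicCell l x = a then 1 else 0

lemma haarOne_eq (m a : ℕ) (x : Set.Ico (0 : ℝ) 1) :
    haarOne m a x = dyadicInd m (2 * a) x - dyadicInd m (2 * a + 1) x := by
  have h1 := mem_Ico_iff_dyadicCell_eq m (2 * a) x
  have h2 := mem_Ico_iff_dyadicCell_eq m (2 * a + 1) x
  push_cast at h1 h2
  rw [add_assoc, one_add_one_eq_two] at h2
  unfold haarOne dyadicInd
  simp only [h1, h2]
  split_ifs <;> first | omega | norm_num

lemma measurable_dyadicInd (l a : ℕ) : Measurable (dyadicInd l a) :=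
  Measurable.ite (measurable_dyadicCell l (measurableSet_singleton a)) measurable_const
    measurable_const

lemma dyadicInd_nonneg (l a : ℕ) (x : Set.Ico (0 : ℝ) 1) : 0 ≤ dyadicInd l a x := by
  unfold dyadicInd; split_ifs <;> norm_num

lemma dyadicInd_le_one (l a : ℕ) (x : Set.Ico (0 : ℝ) 1) : dyadicInd l a x ≤ 1 := by
  unfold dyadicInd; split_ifs <;> norm_num

lemma abs_dyadicInd_le_one (l a : ℕ) (x : Set.Ico (0 : ℝ) 1) : |dyadicInd l a x| ≤ 1 := by
  rw [abs_of_nonneg (dyadicInd_nonneg _ _ _)]; exact dyadicInd_le_one _ _ _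

lemma measurable_haarOne (m a : ℕ) : Measurable (haarOne m a) := by
  rw [show haarOne m a = fun x => dyadicInd m (2 * a) x - dyadicInd m (2 * a + 1) x from
    funext (haarOne_eq m a)]
  exact (measurable_dyadicInd _ _).sub (measurable_dyadicInd _ _)

lemma abs_haarOne_le_one (m a : ℕ) (x : Set.Ico (0 : ℝ) 1) : |haarOne m a x| ≤ 1 := by
  rw [haarOne_eq]; unfold dyadicInd; split_ifs <;> norm_num

lemma haarOne_zero_zero (x : Set.Ico (0 : ℝ) 1) : haarOne 0 0 x = 1 := by
  rw [haarOne_eq]; simp [dyadicInd, dyadicCell_zero]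

lemma dyadicInd_zero_zero (x : Set.Ico (0 : ℝ) 1) : dyadicInd 0 0 x = 1 := by
  simp [dyadicInd, dyadicCell_zero]

lemma dyadicInd_zero_eq_haarOne (a : ℕ) : dyadicInd 0 a = haarOne 0 a := by
  funext x
  rw [haarOne_eq]; simp only [dyadicInd, dyadicCell_zero]
  split_ifs <;> first | omega | contradiction | norm_num

/-- Such a position lies to the right of `[0,1)`. For `m = 0` the truncated exponent `m - 1` is `0`,
so only position `0` is excluded. -/
lemma haarOne_eq_zero_of_le {m a : ℕ} (h : 2 ^ (m - 1) ≤ a) (x : Set.Ico (0 : ℝ) 1) :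
    haarOne m a x = 0 := by
  rw [haarOne_eq]
  have h1 := dyadicCell_lt m x
  have : 2 ^ m ≤ 2 * a := by
    rcases m with _ | m
    · simp at h ⊢; omega
    · simp at h; rw [pow_succ]; omega
  simp only [dyadicInd]
  rw [if_neg (by omega), if_neg (by omega), sub_zero]

lemma haarOne_succ_sq (m a : ℕ) (x : Set.Ico (0 : ℝ) 1) :
    haarOne (m + 1) a x * haarOne (m + 1) a x = dyadicInd m a x := by
  rw [haarOne_eq]
  have := dyadicCell_succ_div m x
  simp only [dyadicInd]
  split_ifs <;> first | omega | norm_num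

/-- A half of an interval is the average of the whole interval and plus or minus its Haar function.
This is what turns Haar bounds into bounds for dyadic intervals. -/
lemma dyadicInd_succ (l a : ℕ) (x : Set.Ico (0 : ℝ) 1) :
    dyadicInd (l + 1) a x = 2⁻¹ * dyadicInd l (a / 2) x +
      (if Even a then 2⁻¹ else -2⁻¹) * haarOne (l + 1) (a / 2) x := by
  rw [haarOne_eq]; simp only [Nat.even_iff]
  have := dyadicCell_succ_div l x
  simp only [dyadicInd]
  split_ifs <;> first | omega | norm_num

/-- A Haar function is constant on the support of a finer one. -/
lemma haarOne_mul_haarOne_of_lt {m m' : ℕ} (h : m < m') (a a' : ℕ) :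
    ∃ c : ℝ, ∀ x, haarOne m a x * haarOne m' a' x = c * haarOne m' a' x := by
  obtain ⟨j, rfl⟩ := Nat.exists_eq_add_of_lt h
  -- The finer function lives on the cell `a'` of level `m + j`, whose ancestor of level `m` is `a'
  -- / 2 ^ j`; the constant is the value of the coarser function on that ancestor.
  refine ⟨(if a' / 2 ^ j = 2 * a then 1 else 0) - (if a' / 2 ^ j = 2 * a + 1 then 1 else 0),
    fun x => ?_⟩
  rw [haarOne_eq, haarOne_eq]
  have h1 := dyadicCell_succ_div (m + j) x
  have h2 := dyadicCell_add_div m j x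
  by_cases h3 : dyadicCell (m + j) x = a'
  · rw [h3] at h2
    simp only [dyadicInd, h2]
  · have h4 : dyadicInd (m + j + 1) (2 * a') x = 0 := by
      unfold dyadicInd; rw [if_neg (by omega)]
    have h5 : dyadicInd (m + j + 1) (2 * a' + 1) x = 0 := by
      unfold dyadicInd; rw [if_neg (by omega)]
    rw [h4, h5]; simp

lemma haarOne_mul_haarOne_of_ne (m : ℕ) {a a' : ℕ} (h : a ≠ a') (x : Set.Ico (0 : ℝ) 1) :
    haarOne m a x * haarOne m a' x = 0 := by
  rw [haarOne_eq, haarOne_eq]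
  simp only [dyadicInd]
  split_ifs <;> first | omega | norm_num

/-! ### Integrals and orthogonality in one coordinate -/

/-- Lebesgue measure on `[0,1)`. -/
noncomputable def lebesgueIco : Measure (Set.Ico (0 : ℝ) 1) :=
  (volume : Measure ℝ).comap Subtype.val

instance : IsProbabilityMeasure lebesgueIco := by
  refine ⟨?_⟩
  rw [lebesgueIco, comap_subtype_coe_apply measurableSet_Ico, Set.image_univ, Subtype.range_coe]
  simp

lemma lebesgueCube_eq (d : ℕ) : lebesgueCube d = Measure.pi fun _ => lebesgueIco := rfl

instance (d : ℕ) : IsProbabilityMeasure (lebesgueCube d) := by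
  rw [lebesgueCube_eq]; infer_instance

lemma integral_dyadicInd (l a : ℕ) :
    ∫ x, dyadicInd l a x ∂lebesgueIco = if a < 2 ^ l then ((2 : ℝ) ^ l)⁻¹ else 0 := by
  by_cases ha : a < 2 ^ l
  · have h : ∀ x : Set.Ico (0 : ℝ) 1, dyadicInd l a x =
        (Set.Ico ((a : ℝ) / 2 ^ l) ((a + 1 : ℝ) / 2 ^ l)).indicator (fun _ => (1 : ℝ)) x := by
      intro x
      simp only [dyadicInd, Set.indicator_apply, mem_Ico_iff_dyadicCell_eq]
    rw [if_pos ha]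
    simp only [h]
    rw [lebesgueIco, integral_subtype_comap measurableSet_Ico
      (fun x => (Set.Ico ((a : ℝ) / 2 ^ l) ((a + 1 : ℝ) / 2 ^ l)).indicator (fun _ => (1 : ℝ)) x),
      integral_indicator measurableSet_Ico]
    simp only [integral_const, smul_eq_mul, mul_one, measureReal_def]
    rw [Measure.restrict_restrict measurableSet_Ico, Measure.restrict_apply_univ,
      Set.inter_eq_left.mpr]
    · rw [Real.volume_Ico, ENNReal.toReal_ofReal]
      · field_simp; ring
      · rw [sub_nonneg]; gcongr; linarith
    · apply Set.Ico_subset_Ico (by positivity)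
      rw [div_le_one (by positivity)]
      exact_mod_cast ha
  · rw [if_neg ha]
    have : ∀ x, dyadicInd l a x = 0 := fun x => by
      have := dyadicCell_lt l x
      unfold dyadicInd; rw [if_neg (by omega)]
    simp [this]

/-- Measurable functions bounded by `1` are integrable for a finite measure. -/
lemma integrable_of_abs_le_one {E : Type*} [MeasurableSpace E] {m : Measure E} [IsFiniteMeasure m]
    {f : E → ℝ} (hf : Measurable f) (hb : ∀ x, |f x| ≤ 1) : Integrable f m :=
  Integrable.of_bound hf.aestronglyMeasurable 1 (Eventually.of_forall hb)

lemma integral_dyadicInd_le (l a : ℕ) : ∫ x, dyadicInd l a x ∂lebesgueIco ≤ ((2 : ℝ) ^ l)⁻¹ := by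
  rw [integral_dyadicInd]; split_ifs
  · rfl
  · positivity

lemma integral_haarOne {m a : ℕ} (hm : m ≠ 0) : ∫ x, haarOne m a x ∂lebesgueIco = 0 := by
  simp only [haarOne_eq]
  rw [integral_sub (integrable_of_abs_le_one (measurable_dyadicInd _ _) (abs_dyadicInd_le_one _ _))
    (integrable_of_abs_le_one (measurable_dyadicInd _ _) (abs_dyadicInd_le_one _ _)),
    integral_dyadicInd, integral_dyadicInd]
  obtain ⟨m, rfl⟩ := Nat.exists_eq_succ_of_ne_zero hm
  have : 2 ^ (m + 1) = 2 * 2 ^ m := pow_succ' _ _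
  simp only [Nat.succ_eq_add_one]
  split_ifs <;> first | omega | simp

/-- The square is the indicator of an interval of length `2 · 2 ^ (-m)` when `m ≥ 1`. For order `0`
the factor `2` is wasteful, but it makes the bound multiply uniformly over the coordinates. -/
lemma integral_haarOne_mul_self_le (m a : ℕ) :
    ∫ x, haarOne m a x * haarOne m a x ∂lebesgueIco ≤ 2 * ((2 : ℝ) ^ m)⁻¹ := by
  rcases m with _ | m
  · calc ∫ x, haarOne 0 a x * haarOne 0 a x ∂lebesgueIco ≤ ∫ x, 1 ∂lebesgueIco := by
          apply integral_mono_of_nonneg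
          · exact Eventually.of_forall fun x => mul_self_nonneg _
          · exact integrable_const _
          · refine Eventually.of_forall fun x => ?_
            have := abs_le.mp (abs_haarOne_le_one 0 a x)
            simp only; nlinarith
      _ ≤ _ := by simp
  · simp only [haarOne_succ_sq]
    refine (integral_dyadicInd_le _ _).trans ?_
    rw [pow_succ]; field_simp; rfl

lemma integral_haarOne_mul_haarOne {m m' a a' : ℕ} (h : (m, a) ≠ (m', a')) :
    ∫ x, haarOne m a x * haarOne m' a' x ∂lebesgueIco = 0 := by
  rcases lt_trichotomy m m' with hm | rfl | hm
  · obtain ⟨c, hc⟩ := haarOne_mul_haarOne_of_lt hm a a'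
    simp only [hc]
    rw [integral_const_mul, integral_haarOne (by omega), mul_zero]
  · simp [haarOne_mul_haarOne_of_ne m (show a ≠ a' by rintro rfl; exact h rfl)]
  · obtain ⟨c, hc⟩ := haarOne_mul_haarOne_of_lt hm a' a
    simp only [mul_comm (haarOne m a _), hc]
    rw [integral_const_mul, integral_haarOne (by omega), mul_zero]

/-! ### Products of coordinate functions -/

section Product
variable {d : ℕ}

lemma integral_prod_coord (g : Fin d → Set.Ico (0 : ℝ) 1 → ℝ) :
    ∫ x, ∏ i, g i (x i) ∂(lebesgueCube d) = ∏ i, ∫ x, g i x ∂lebesgueIco := by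
  rw [lebesgueCube_eq]
  exact integral_fintype_prod_eq_prod g

lemma measurable_prod_coord {g : Fin d → Set.Ico (0 : ℝ) 1 → ℝ} (hg : ∀ i, Measurable (g i))
    (s : Finset (Fin d)) : Measurable fun x : UnitCube d => ∏ i ∈ s, g i (x i) :=
  Finset.measurable_prod _ fun i _ => (hg i).comp (measurable_pi_apply i)

lemma abs_prod_coord_le_one {g : Fin d → Set.Ico (0 : ℝ) 1 → ℝ} (hg : ∀ i x, |g i x| ≤ 1)
    (s : Finset (Fin d)) (x : UnitCube d) : |∏ i ∈ s, g i (x i)| ≤ 1 := by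
  rw [Finset.abs_prod]
  exact Finset.prod_le_one (fun i _ => abs_nonneg _) fun i _ => hg i (x i)

variable (m a : Fin d → ℕ)

lemma measurable_haar : Measurable (haar m a) :=
  measurable_prod_coord (fun i => measurable_haarOne (m i) (a i)) Finset.univ

lemma abs_haar_le_one (x : UnitCube d) : |haar m a x| ≤ 1 :=
  abs_prod_coord_le_one (fun i => abs_haarOne_le_one (m i) (a i)) Finset.univ x

variable {m a}

lemma integral_haar (h : 1 ≤ ∑ i, m i) : ∫ x, haar m a x ∂(lebesgueCube d) = 0 := by
  unfold haar
  rw [integral_prod_coord fun i => haarOne (m i) (a i)]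
  obtain ⟨i, -, hi⟩ := Finset.exists_ne_zero_of_sum_ne_zero (show ∑ i, m i ≠ 0 by omega)
  exact Finset.prod_eq_zero (Finset.mem_univ i) (integral_haarOne hi)

lemma integral_haar_mul_haar {m' a' : Fin d → ℕ} (h : (m, a) ≠ (m', a')) :
    ∫ x, haar m a x * haar m' a' x ∂(lebesgueCube d) = 0 := by
  unfold haar
  simp only [← Finset.prod_mul_distrib]
  rw [integral_prod_coord fun i x => haarOne (m i) (a i) x * haarOne (m' i) (a' i) x]
  have : ∃ i, (m i, a i) ≠ (m' i, a' i) := by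
    by_contra! hc
    apply h
    simp only [Prod.mk.injEq] at hc ⊢
    exact ⟨funext fun i => (hc i).1, funext fun i => (hc i).2⟩
  obtain ⟨i, hi⟩ := this
  exact Finset.prod_eq_zero (Finset.mem_univ i) (integral_haarOne_mul_haarOne hi)

lemma integral_haar_mul_self_le :
    ∫ x, haar m a x * haar m a x ∂(lebesgueCube d) ≤ 2 ^ d * ((2 : ℝ) ^ (∑ i, m i))⁻¹ := by
  unfold haar
  simp only [← Finset.prod_mul_distrib]
  rw [integral_prod_coord fun i x => haarOne (m i) (a i) x * haarOne (m i) (a i) x]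
  calc _ ≤ ∏ i : Fin d, 2 * ((2 : ℝ) ^ (m i))⁻¹ :=
        Finset.prod_le_prod (fun i _ => integral_nonneg fun x => mul_self_nonneg _)
          fun i _ => integral_haarOne_mul_self_le _ _
    _ = _ := by
        rw [Finset.prod_mul_distrib, Finset.prod_inv_distrib, Finset.prod_pow_eq_pow_sum]; simp

lemma haar_eq_zero_of_notMem (h : a ∉ haarPositions m) (x : UnitCube d) : haar m a x = 0 := by
  simp only [haarPositions, Fintype.mem_piFinset, Finset.mem_range, not_forall, not_lt] at h
  obtain ⟨i, hi⟩ := h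
  exact Finset.prod_eq_zero (Finset.mem_univ i) (haarOne_eq_zero_of_le hi _)

lemma haar_trichotomy (x : UnitCube d) : haar m a x = 1 ∨ haar m a x = -1 ∨ haar m a x = 0 := by
  unfold haar
  refine Finset.prod_induction _ (fun r : ℝ => r = 1 ∨ r = -1 ∨ r = 0) ?_ (by simp) ?_
  · rintro r s (rfl | rfl | rfl) (rfl | rfl | rfl) <;> simp
  · intro i _
    rw [haarOne_eq]; unfold dyadicInd; split_ifs <;> norm_num

/-- Haar functions with the same order vector have disjoint supports: in each coordinate the
position is half the index of the cell containing the point. -/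
lemma sum_abs_haar_le_one (m : Fin d → ℕ) (s : Finset (Fin d → ℕ)) (x : UnitCube d) :
    ∑ a ∈ s, |haar m a x| ≤ 1 := by
  have h : ∀ a ∈ s, |haar m a x| ≤ if a = (fun i => dyadicCell (m i) (x i) / 2) then 1 else 0 := by
    intro a _
    split_ifs with ha
    · exact abs_haar_le_one _ _ _
    · obtain ⟨i, hi⟩ := Function.ne_iff.mp ha
      have : haar m a x = 0 := by
        refine Finset.prod_eq_zero (Finset.mem_univ i) ?_
        rw [haarOne_eq]; unfold dyadicInd
        rw [if_neg (by omega), if_neg (by omega), sub_zero]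
      simp [this]
  refine (Finset.sum_le_sum h).trans ?_
  rw [Finset.sum_ite_eq']
  split_ifs <;> norm_num

end Product

/-! ### The Haar density -/

section Density
variable {d : ℕ}

/-- Stars and bars: order vectors of sum `i` correspond to multisets of size `i` on `d` elements. -/
lemma card_haarOrders_le (hd : 1 ≤ d) (h : ℕ) : (haarOrders d h).card ≤ haarWeight d h := by
  have hsub : haarOrders d h ⊆ (Finset.Icc 1 h).biUnion fun i =>
      (haarOrders d h).filter fun m => ∑ j, m j = i := by
    intro m hm
    have hm' := hm
    simp only [haarOrders, Finset.mem_filter] at hm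
    simp only [Finset.mem_biUnion, Finset.mem_Icc, Finset.mem_filter]
    exact ⟨_, hm.2, hm', rfl⟩
  refine (Finset.card_le_card hsub).trans (Finset.card_biUnion_le.trans ?_)
  refine Finset.sum_le_sum fun i _ => ?_
  rw [← Fintype.card_coe]
  have hinj : Function.Injective fun m : ((haarOrders d h).filter fun m => ∑ j, m j = i) =>
      (Sym.equivNatSumOfFintype (Fin d) i).symm ⟨m.1, (Finset.mem_filter.mp m.2).2⟩ := by
    intro m m' hmm
    have := (Sym.equivNatSumOfFintype (Fin d) i).symm.injective hmm
    exact Subtype.ext (Subtype.mk.inj this)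
  refine (Fintype.card_le_of_injective _ hinj).trans_eq ?_
  rw [Sym.card_sym_eq_choose, Fintype.card_fin, add_comm d i]
  exact Nat.choose_symm_of_eq_add (by omega)

lemma one_le_haarWeight (hd : 1 ≤ d) {h : ℕ} (hh : 1 ≤ h) : 1 ≤ haarWeight d h := by
  have : (1 + d - 1).choose (d - 1) ≤ haarWeight d h :=
    Finset.single_le_sum (f := fun i => (i + d - 1).choose (d - 1)) (fun _ _ => Nat.zero_le _)
      (Finset.mem_Icc.mpr ⟨le_refl 1, hh⟩)
  exact (Nat.choose_pos (by omega)).trans_le this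

lemma haarWeight_mono {h h' : ℕ} (hh : h ≤ h') : haarWeight d h ≤ haarWeight d h' :=
  Finset.sum_le_sum_of_subset (Finset.Icc_subset_Icc le_rfl hh)

lemma haarWeight_le_choose (hd : 1 ≤ d) (h : ℕ) : haarWeight d h ≤ (h + d).choose d := by
  obtain ⟨e, rfl⟩ := Nat.exists_eq_add_of_le' hd
  rw [← add_assoc, ← Nat.sum_range_add_choose]
  refine Finset.sum_le_sum_of_subset fun i hi => ?_
  simp only [Finset.mem_Icc, Finset.mem_range] at hi ⊢
  omega

/-- The sign pattern in the definition of `haarDensity`. -/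
noncomputable def haarSum {k : ℕ} (h : ℕ) (z : Fin k → UnitCube d) (x : UnitCube d) : ℝ :=
  ∑ m ∈ haarOrders d h, ∑ a ∈ haarPositions m, Real.sign (∑ i, -haar m a (z i)) * haar m a x

lemma haarDensity_eq (β : ℝ) (n : ℕ) {k : ℕ} (z : Fin k → UnitCube d) (x : UnitCube d) :
    haarDensity β n z x =
      1 + β / (2 * haarWeight d (Nat.log 2 n)) * haarSum (Nat.log 2 n) z x := rfl

lemma abs_sign_le_one (r : ℝ) : |Real.sign r| ≤ 1 := by
  rcases Real.sign_apply_eq r with h | h | h <;> simp [h]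

lemma abs_haarSum_le (hd : 1 ≤ d) {k : ℕ} (h : ℕ) (z : Fin k → UnitCube d) (x : UnitCube d) :
    |haarSum h z x| ≤ haarWeight d h := by
  have : ∀ m ∈ haarOrders d h,
      |∑ a ∈ haarPositions m, Real.sign (∑ i, -haar m a (z i)) * haar m a x| ≤ 1 := by
    intro m _
    refine (Finset.abs_sum_le_sum_abs _ _).trans (le_trans ?_ (sum_abs_haar_le_one m (haarPositions m) x))
    refine Finset.sum_le_sum fun a _ => ?_
    rw [abs_mul]
    exact mul_le_of_le_one_left (abs_nonneg _) (abs_sign_le_one _)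
  refine (Finset.abs_sum_le_sum_abs _ _).trans ((Finset.sum_le_sum this).trans ?_)
  simpa using card_haarOrders_le hd h

lemma abs_haarDensity_sub_one_le (hd : 1 ≤ d) {β : ℝ} (hβ : 0 ≤ β) (n : ℕ) {k : ℕ}
    (z : Fin k → UnitCube d) (x : UnitCube d) : |haarDensity β n z x - 1| ≤ β / 2 := by
  rw [haarDensity_eq, add_sub_cancel_left, abs_mul, abs_of_nonneg (by positivity)]
  have h := abs_haarSum_le hd (Nat.log 2 n) z x
  rcases Nat.eq_zero_or_pos (haarWeight d (Nat.log 2 n)) with h0 | h0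
  · rw [h0]; simp; linarith
  · have h1 : (0 : ℝ) < haarWeight d (Nat.log 2 n) := by exact_mod_cast h0
    calc _ ≤ β / (2 * haarWeight d (Nat.log 2 n)) * haarWeight d (Nat.log 2 n) := by gcongr
      _ = β / 2 := by field_simp

lemma measurable_sign : Measurable Real.sign := by
  unfold Real.sign
  exact Measurable.ite measurableSet_Iio measurable_const
    (Measurable.ite measurableSet_Ioi measurable_const measurable_const)

lemma measurable_haarDensity (β : ℝ) (n k : ℕ) :
    Measurable fun p : (Fin k → UnitCube d) × UnitCube d => haarDensity β n p.1 p.2 := by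
  unfold haarDensity
  refine measurable_const.add (measurable_const.mul ?_)
  refine Finset.measurable_sum _ fun m _ => Finset.measurable_sum _ fun a _ => ?_
  refine (measurable_sign.comp (Finset.measurable_sum _ fun i _ => ?_)).mul
    ((measurable_haar m a).comp measurable_snd)
  exact ((measurable_haar m a).comp ((measurable_pi_apply i).comp measurable_fst)).neg

lemma isThinningStrategy_haarStrategy (hd : 1 ≤ d) {β : ℝ} (hβ0 : 0 ≤ β) (hβ1 : β ≤ 1) :
    IsThinningStrategy β (haarStrategy d β) where
  measurable k := (measurable_haarDensity β (k + 1) k).sub_const _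
  mem_Icc k z x := by
    have := abs_le.mp (abs_haarDensity_sub_one_le hd hβ0 (k + 1) z x)
    unfold haarStrategy
    constructor <;> linarith
  one_sub_le k z := by
    refine Eventually.of_forall fun x => ?_
    have := abs_le.mp (abs_haarDensity_sub_one_le hd hβ0 (k + 1) z x)
    unfold haarStrategy
    linarith

lemma integral_haarDensity_mul {φ : UnitCube d → ℝ} (hφ : Measurable φ) (hb : ∀ x, |φ x| ≤ 1)
    (β : ℝ) (n : ℕ) {k : ℕ} (z : Fin k → UnitCube d) :
    ∫ x, haarDensity β n z x * φ x ∂(lebesgueCube d) = ∫ x, φ x ∂(lebesgueCube d) +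
      β / (2 * haarWeight d (Nat.log 2 n)) * ∑ m ∈ haarOrders d (Nat.log 2 n),
        ∑ a ∈ haarPositions m, Real.sign (∑ i, -haar m a (z i)) *
          ∫ x, haar m a x * φ x ∂(lebesgueCube d) := by
  have hint : ∀ m a, Integrable (fun x => haar m a x * φ x) (lebesgueCube d) := fun m a =>
    integrable_of_abs_le_one ((measurable_haar m a).mul hφ) fun x => by
      rw [abs_mul]; exact mul_le_one₀ (abs_haar_le_one m a x) (abs_nonneg _) (hb x)
  simp only [haarDensity, add_mul, one_mul, mul_assoc, Finset.sum_mul]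
  have h1 : ∀ m a, Integrable (fun x => Real.sign (∑ i, -haar m a (z i)) * (haar m a x * φ x))
      (lebesgueCube d) := fun m a => (hint m a).const_mul _
  rw [integral_add (integrable_of_abs_le_one hφ hb)
    ((integrable_finsetSum _ fun m _ => integrable_finsetSum _ fun a _ => h1 m a).const_mul _),
    integral_const_mul, integral_finsetSum _ fun m _ => integrable_finsetSum _ fun a _ => h1 m a]
  congr 2
  refine Finset.sum_congr rfl fun m _ => ?_
  rw [integral_finsetSum _ fun a _ => h1 m a]
  exact Finset.sum_congr rfl fun a _ => integral_const_mul _ _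

lemma mem_haarOrders {h : ℕ} {m : Fin d → ℕ} :
    m ∈ haarOrders d h ↔ 1 ≤ ∑ i, m i ∧ ∑ i, m i ≤ h := by
  simp only [haarOrders, Finset.mem_filter, Fintype.mem_piFinset, Finset.mem_range,
    and_iff_right_iff_imp, Nat.lt_succ_iff]
  rintro ⟨-, h2⟩ i
  exact (Finset.single_le_sum (fun _ _ => Nat.zero_le _) (Finset.mem_univ i)).trans h2

lemma integral_haarDensity (β : ℝ) (n : ℕ) {k : ℕ} (z : Fin k → UnitCube d) :
    ∫ x, haarDensity β n z x ∂(lebesgueCube d) = 1 := by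
  have h := integral_haarDensity_mul (φ := fun _ => 1) measurable_const (by simp) β n z
  simp only [mul_one] at h
  rw [h, Finset.sum_eq_zero]
  · simp
  · intro m hm
    refine Finset.sum_eq_zero fun a _ => ?_
    rw [integral_haar (mem_haarOrders.mp hm).1, mul_zero]

/-- The drift of a Haar function that the strategy controls. -/
lemma integral_haarDensity_mul_haar (β : ℝ) {n : ℕ} {k : ℕ} (z : Fin k → UnitCube d)
    {m a : Fin d → ℕ} (hm : m ∈ haarOrders d (Nat.log 2 n)) (ha : a ∈ haarPositions m) :
    ∫ x, haarDensity β n z x * haar m a x ∂(lebesgueCube d) =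
      -(β / (2 * haarWeight d (Nat.log 2 n)) * Real.sign (∑ i, haar m a (z i)) *
        ∫ x, haar m a x * haar m a x ∂(lebesgueCube d)) := by
  rw [integral_haarDensity_mul (measurable_haar m a) (abs_haar_le_one m a),
    integral_haar (mem_haarOrders.mp hm).1, zero_add, Finset.sum_eq_single m, Finset.sum_eq_single a]
  · rw [Finset.sum_neg_distrib, Real.sign_neg]; ring
  · intro a' _ h
    rw [integral_haar_mul_haar (by simp [h]), mul_zero]
  · exact fun h => absurd ha h
  · intro m' _ h
    refine Finset.sum_eq_zero fun a' _ => ?_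
    rw [integral_haar_mul_haar (by simp [h]), mul_zero]
  · exact fun h => absurd hm h

/-- Haar functions of an order above the controlled range have no drift. -/
lemma integral_haarDensity_mul_haar_of_lt (β : ℝ) {n : ℕ} {k : ℕ} (z : Fin k → UnitCube d)
    {m a : Fin d → ℕ} (hm : Nat.log 2 n < ∑ i, m i) :
    ∫ x, haarDensity β n z x * haar m a x ∂(lebesgueCube d) = 0 := by
  rw [integral_haarDensity_mul (measurable_haar m a) (abs_haar_le_one m a),
    integral_haar (by omega), zero_add, Finset.sum_eq_zero, mul_zero]
  intro m' hm'
  refine Finset.sum_eq_zero fun a' _ => ?_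
  have : m' ≠ m := by rintro rfl; have := (mem_haarOrders.mp hm').2; omega
  rw [integral_haar_mul_haar (by simp [this]), mul_zero]

end Density

/-! ### Resampling -/

section Resample
variable {Ω E F : Type*} [MeasurableSpace Ω] [MeasurableSpace E] [MeasurableSpace F] {μ : Measure Ω}

lemma lintegral_indepFun [IsProbabilityMeasure μ] {X : Ω → E} {Y : Ω → F} (hX : Measurable X)
    (hY : Measurable Y) (h : IndepFun X Y μ) {G : E × F → ℝ≥0∞} (hG : Measurable G) :
    ∫⁻ ω, G (X ω, Y ω) ∂μ = ∫⁻ ω, ∫⁻ ω', G (X ω, Y ω') ∂μ ∂μ := by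
  rw [← lintegral_map (f := G) (g := fun ω => (X ω, Y ω)) hG (hX.prodMk hY),
    h.map_prod_eq_prod_map_map hX.aemeasurable hY.aemeasurable]
  have := Measure.isProbabilityMeasure_map (μ := μ) hX.aemeasurable
  have := Measure.isProbabilityMeasure_map (μ := μ) hY.aemeasurable
  rw [lintegral_prod _ hG.aemeasurable, lintegral_map hG.lintegral_prod_right' hX]
  refine lintegral_congr fun ω => ?_
  exact lintegral_map (hG.comp measurable_prodMk_left) hY

/-- If `G y e` depends on `y` only through its first `N` terms, then the `N`-th term of an
independent sequence can be replaced in its second argument by a fresh copy. -/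
lemma lintegral_resample [Nonempty E] [IsProbabilityMeasure μ] {Y : ℕ → Ω → E}
    (hY : ∀ n, Measurable (Y n)) (hind : iIndepFun Y μ) (N : ℕ) {G : (ℕ → E) × E → ℝ≥0∞}
    (hG : Measurable G) (hdep : ∀ y y' e, (∀ i < N, y i = y' i) → G (y, e) = G (y', e)) :
    ∫⁻ ω, G (fun n => Y n ω, Y N ω) ∂μ = ∫⁻ ω, ∫⁻ e, G (fun n => Y n ω, e) ∂(μ.map (Y N)) ∂μ := by
  let c : E := Classical.arbitrary E
  -- Filling the terms from `N` on with a constant does not change `G`, and makes it a function of a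
  -- finite block that is independent of `Y N`.
  let ext : (Finset.range N → E) → ℕ → E := fun y i =>
    if h : i ∈ Finset.range N then y ⟨i, h⟩ else c
  have hext : Measurable ext := by
    refine measurable_pi_lambda _ fun i => ?_
    by_cases h : i ∈ Finset.range N
    · simp only [ext, h, dif_pos]; exact measurable_pi_apply _
    · simp only [ext, h, dif_neg, not_false_eq_true]; exact measurable_const
  let A : Ω → Finset.range N → E := fun ω i => Y i ω
  have hA : Measurable A := measurable_pi_lambda _ fun i => hY i
  have hagree : ∀ ω e, G (fun n => Y n ω, e) = G (ext (A ω), e) := fun ω e => by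
    refine hdep _ _ _ fun i hi => ?_
    simp only [ext, A, Finset.mem_range, hi, dif_pos]
  have hAY : IndepFun A (Y N) μ := by
    have := hind.indepFun_finset (Finset.range N) {N} (by simp) hY
    exact this.comp (φ := id) (ψ := fun y : (({N} : Finset ℕ) → E) => y ⟨N, by simp⟩) measurable_id
      (measurable_pi_apply _)
  simp only [hagree]
  have hG' : Measurable fun p : (Finset.range N → E) × E => G (ext p.1, p.2) :=
    hG.comp ((hext.comp measurable_fst).prodMk measurable_snd)
  rw [lintegral_indepFun hA (hY N) hAY hG']
  refine lintegral_congr fun ω => ?_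
  exact (lintegral_map (hG'.comp (measurable_prodMk_left (x := A ω))) (hY N)).symm

end Resample

/-! ### The state of a thinning strategy -/

section State
variable {d : ℕ} (f : KeepRule d)

lemma thinningState_succ (x : ℕ → UnitCube d) (u : ℕ → ℝ) (k : ℕ) :
    thinningState f x u (k + 1) =
      (Fin.snoc (thinningState f x u k).1 (x (k + (thinningState f x u k).2 +
          if f k (thinningState f x u k).1 (x (k + (thinningState f x u k).2)) < u k then 1 else 0)),
        (thinningState f x u k).2 +
          if f k (thinningState f x u k).1 (x (k + (thinningState f x u k).2)) < u k then 1 else 0) :=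
  rfl

lemma thinningState_fst_apply (x : ℕ → UnitCube d) (u : ℕ → ℝ) (k : ℕ) (i : Fin k) :
    (thinningState f x u k).1 i = thinnedSeq f x u i := by
  induction k with
  | zero => exact i.elim0
  | succ k ih =>
    refine Fin.lastCases ?_ (fun j => ?_) i
    · rfl
    · rw [thinningState_succ]
      simp only [Fin.snoc_castSucc, Fin.val_castSucc]
      exact ih j

/-- After `k` rounds with at most `r` rejections only the first `k + r` offered points have been
used. Bounding the rejections on one side suffices, and the count never decreases, so the induction
keeps the same `r`. -/
lemma thinningState_congr {x x' : ℕ → UnitCube d} {u u' : ℕ → ℝ} (k : ℕ) {r : ℕ}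
    (hx : ∀ i < k + r, x i = x' i) (hu : ∀ i < k, u i = u' i)
    (hr : (thinningState f x u k).2 ≤ r) :
    thinningState f x u k = thinningState f x' u' k := by
  induction k with
  | zero => rfl
  | succ k ih =>
    have h2 : (thinningState f x u k).2 ≤ r :=
      le_trans (by rw [thinningState_succ]; exact Nat.le_add_right _ _) hr
    have h1 := ih (fun i hi => hx i (by omega)) (fun i hi => hu i (by omega)) h2
    rw [thinningState_succ] at hr ⊢
    rw [thinningState_succ, ← h1, ← hx (k + (thinningState f x u k).2) (by omega), ← hu k (by omega)]
    simp only at hr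
    rw [← hx (k + (thinningState f x u k).2 + _) (by omega)]

variable {f}

lemma measurable_snoc {E : Type*} [MeasurableSpace E] (k : ℕ) :
    Measurable fun p : (Fin k → E) × E => (Fin.snoc p.1 p.2 : Fin (k + 1) → E) := by
  refine measurable_pi_lambda _ fun i => ?_
  refine Fin.lastCases ?_ (fun j => ?_) i
  · simp only [Fin.snoc_last]; exact measurable_snd
  · simp only [Fin.snoc_castSucc]; exact (measurable_pi_apply j).comp measurable_fst

lemma measurable_eval_nat {E : Type*} [MeasurableSpace E] :
    Measurable fun p : (ℕ → E) × ℕ => p.1 p.2 :=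
  measurable_from_prod_countable_left fun n => measurable_pi_apply n

lemma measurable_thinningState
    (hf : ∀ k, Measurable fun p : (Fin k → UnitCube d) × UnitCube d => f k p.1 p.2) (k : ℕ) :
    Measurable fun p : (ℕ → UnitCube d) × (ℕ → ℝ) => thinningState f p.1 p.2 k := by
  induction k with
  | zero => exact measurable_const
  | succ k ih =>
    simp only [thinningState_succ]
    have h1 : Measurable fun p : (ℕ → UnitCube d) × (ℕ → ℝ) => (thinningState f p.1 p.2 k).1 :=
      measurable_fst.comp ih
    have h2 : Measurable fun p : (ℕ → UnitCube d) × (ℕ → ℝ) => (thinningState f p.1 p.2 k).2 :=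
      measurable_snd.comp ih
    have h3 : Measurable fun p : (ℕ → UnitCube d) × (ℕ → ℝ) =>
        p.1 (k + (thinningState f p.1 p.2 k).2) :=
      measurable_eval_nat.comp (measurable_fst.prodMk (h2.const_add k))
    have h4 : Measurable fun p : (ℕ → UnitCube d) × (ℕ → ℝ) =>
        if f k (thinningState f p.1 p.2 k).1 (p.1 (k + (thinningState f p.1 p.2 k).2)) < p.2 k
          then 1 else 0 :=
      Measurable.ite (measurableSet_lt ((hf k).comp (h1.prodMk h3))
        ((measurable_pi_apply k).comp measurable_snd)) measurable_const measurable_const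
    exact ((measurable_snoc k).comp (h1.prodMk (measurable_eval_nat.comp
      (measurable_fst.prodMk ((h2.const_add k).add h4))))).prodMk (h2.add h4)

end State

/-! ### The conditional law of the next point -/

section NextPoint
variable {d : ℕ}

/-- Offering a point `y`, kept with probability `f y`, and otherwise taking the fresh point `y'`,
gives a point with density `f + c`, where `c` is the probability of rejection. -/
lemma lintegral_keep_or_replace {E : Type*} [MeasurableSpace E] {m : Measure E}
    [IsProbabilityMeasure m] {f : E → ℝ} (hf : Measurable f) (hf01 : ∀ x, f x ∈ Set.Icc (0 : ℝ) 1)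
    {φ : E → ℝ≥0∞} (hφ : Measurable φ) :
    ∫⁻ v in Set.Icc (0 : ℝ) 1, ∫⁻ y, ∫⁻ y', φ (if f y < v then y' else y) ∂m ∂m =
      ∫⁻ y, φ y * ENNReal.ofReal (f y + (1 - ∫ x, f x ∂m)) ∂m := by
  have hfi : Integrable f m := Integrable.of_bound hf.aestronglyMeasurable 1
    (Eventually.of_forall fun x => by
      rw [Real.norm_eq_abs, abs_le]; exact ⟨by linarith [(hf01 x).1], (hf01 x).2⟩)
  have hle : ∫ x, f x ∂m ≤ 1 := by
    simpa using integral_mono hfi (integrable_const (1 : ℝ)) (fun x => (hf01 x).2)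
  have h1 : ∀ v y, ∫⁻ y', φ (if f y < v then y' else y) ∂m =
      if f y < v then ∫⁻ y', φ y' ∂m else φ y := by
    intro v y
    split_ifs <;> simp
  simp only [h1]
  have hmeas : Measurable fun p : ℝ × E => if f p.2 < p.1 then ∫⁻ y', φ y' ∂m else φ p.2 :=
    Measurable.ite (measurableSet_lt (hf.comp measurable_snd) measurable_fst) measurable_const
      (hφ.comp measurable_snd)
  rw [lintegral_lintegral_swap hmeas.aemeasurable]
  have h2 : ∀ y, ∫⁻ v in Set.Icc (0 : ℝ) 1, (if f y < v then ∫⁻ y', φ y' ∂m else φ y) =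
      φ y * ENNReal.ofReal (f y) + ENNReal.ofReal (1 - f y) * ∫⁻ y', φ y' ∂m := by
    intro y
    have e : ∀ v, (if f y < v then ∫⁻ y', φ y' ∂m else φ y) =
        (Set.Iic (f y)).indicator (fun _ => φ y) v +
        (Set.Ioi (f y)).indicator (fun _ => ∫⁻ y', φ y' ∂m) v := by
      intro v
      by_cases hv : f y < v
      · simp [hv]
      · simp [hv, not_lt.mp hv]
    simp only [e]
    rw [lintegral_add_left (measurable_const.indicator measurableSet_Iic),
      lintegral_indicator_const measurableSet_Iic, lintegral_indicator_const measurableSet_Ioi,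
      Measure.restrict_apply measurableSet_Iic, Measure.restrict_apply measurableSet_Ioi]
    have e1 : Set.Iic (f y) ∩ Set.Icc 0 1 = Set.Icc 0 (f y) := by
      ext v; simp only [Set.mem_inter_iff, Set.mem_Iic, Set.mem_Icc]
      have := (hf01 y).2
      constructor
      · rintro ⟨a, b, -⟩; exact ⟨b, a⟩
      · rintro ⟨a, b⟩; exact ⟨b, a, b.trans this⟩
    have e2 : Set.Ioi (f y) ∩ Set.Icc 0 1 = Set.Ioc (f y) 1 := by
      ext v; simp only [Set.mem_inter_iff, Set.mem_Ioi, Set.mem_Icc, Set.mem_Ioc]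
      have := (hf01 y).1
      constructor
      · rintro ⟨a, -, b⟩; exact ⟨a, b⟩
      · rintro ⟨a, b⟩; exact ⟨a, by linarith, b⟩
    rw [e1, e2, Real.volume_Icc, Real.volume_Ioc, sub_zero, mul_comm (∫⁻ y', φ y' ∂m)]
  simp only [h2]
  have hφf : Measurable fun y => φ y * ENNReal.ofReal (f y) := hφ.mul hf.ennreal_ofReal
  have hf1 : Measurable fun y => ENNReal.ofReal (1 - f y) := (measurable_const.sub hf).ennreal_ofReal
  rw [lintegral_add_left hφf, lintegral_mul_const _ hf1,
    ← ofReal_integral_eq_lintegral_ofReal (f := fun y => 1 - f y) ((integrable_const 1).sub hfi)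
      (Eventually.of_forall fun x => sub_nonneg.mpr (hf01 x).2), integral_sub (integrable_const 1) hfi]
  simp only [integral_const, probReal_univ, smul_eq_mul, mul_one]
  rw [← lintegral_const_mul _ hφ, ← lintegral_add_left hφf]
  refine lintegral_congr fun y => ?_
  rw [ENNReal.ofReal_add (hf01 y).1 (by linarith)]
  ring

variable {Ω : Type*} [MeasurableSpace Ω] {μ : Measure Ω} [IsProbabilityMeasure μ]
  {X : ℕ → Ω → UnitCube d} {U : ℕ → Ω → ℝ}

/-- On the event that `r` points have been rejected before, the next point is chosen from two fresh
points with fresh external randomness. -/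
lemma lintegral_next_point_of_rejected_eq
    (hXmeas : ∀ n, Measurable (X n)) (hUmeas : ∀ n, Measurable (U n))
    (hXlaw : ∀ n, μ.map (X n) = lebesgueCube d)
    (hUlaw : ∀ n, μ.map (U n) = volume.restrict (Set.Icc (0 : ℝ) 1))
    (hXindep : iIndepFun X μ) (hUindep : iIndepFun U μ)
    (hXU : IndepFun (fun ω n => X n ω) (fun ω n => U n ω) μ)
    (f : KeepRule d) (hf : ∀ k, Measurable fun p : (Fin k → UnitCube d) × UnitCube d => f k p.1 p.2)
    (hf01 : ∀ k z x, f k z x ∈ Set.Icc (0 : ℝ) 1)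
    (k r : ℕ) {g : (Fin (k + 1) → UnitCube d) → ℝ≥0∞} (hg : Measurable g) :
    ∫⁻ ω, (if (thinningState f (fun n => X n ω) (fun n => U n ω) k).2 = r then
      g (thinningState f (fun n => X n ω) (fun n => U n ω) (k + 1)).1 else 0) ∂μ =
    ∫⁻ ω, (if (thinningState f (fun n => X n ω) (fun n => U n ω) k).2 = r then
      ∫⁻ y, g (Fin.snoc (thinningState f (fun n => X n ω) (fun n => U n ω) k).1 y) *
        ENNReal.ofReal (f k (thinningState f (fun n => X n ω) (fun n => U n ω) k).1 y +
          (1 - ∫ x, f k (thinningState f (fun n => X n ω) (fun n => U n ω) k).1 x ∂lebesgueCube d))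
        ∂lebesgueCube d else 0) ∂μ := by
  have hne : Nonempty (UnitCube d) := ⟨fun _ => ⟨0, by simp⟩⟩
  -- arguments: offered points, external randomness, the two fresh points, the fresh randomness
  let G : ((ℕ → UnitCube d) × (ℕ → ℝ)) × (UnitCube d × UnitCube d × ℝ) → ℝ≥0∞ := fun p =>
    if (thinningState f p.1.1 p.1.2 k).2 = r then
      g (Fin.snoc (thinningState f p.1.1 p.1.2 k).1
        (if f k (thinningState f p.1.1 p.1.2 k).1 p.2.1 < p.2.2.2 then p.2.2.1 else p.2.1)) else 0
  have hst := measurable_thinningState hf k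
  have hG : Measurable G := by
    have h1 : Measurable fun p : ((ℕ → UnitCube d) × (ℕ → ℝ)) × (UnitCube d × UnitCube d × ℝ) =>
        (thinningState f p.1.1 p.1.2 k).1 := measurable_fst.comp (hst.comp measurable_fst)
    have h2 : Measurable fun p : ((ℕ → UnitCube d) × (ℕ → ℝ)) × (UnitCube d × UnitCube d × ℝ) =>
        (thinningState f p.1.1 p.1.2 k).2 := measurable_snd.comp (hst.comp measurable_fst)
    refine Measurable.ite (h2 (measurableSet_singleton r)) (hg.comp ((measurable_snoc k).comp
      (h1.prodMk (Measurable.ite (measurableSet_lt ((hf k).comp (h1.prodMk (by fun_prop)))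
        (by fun_prop)) (by fun_prop) (by fun_prop))))) measurable_const
  -- On the event of exactly `r` rejections the past involves only `k + r` offered points; if one
  -- side has more than `r` rejections, so does the other, and both values are `0`.
  have hdep : ∀ x x' u u' q, (∀ i < k + r, x i = x' i) → (∀ i < k, u i = u' i) →
      G ((x, u), q) = G ((x', u'), q) := by
    intro x x' u u' q hx hu
    by_cases h : (thinningState f x u k).2 ≤ r
    · simp only [G, thinningState_congr f k hx hu h]
    · have h' : ¬ (thinningState f x' u' k).2 ≤ r := fun h' => h (by
        rw [← thinningState_congr f k (fun i hi => (hx i hi).symm) (fun i hi => (hu i hi).symm) h']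
        exact h')
      simp only [G]
      rw [if_neg (by omega), if_neg (by omega)]
  have hXm : Measurable fun ω n => X n ω := measurable_pi_lambda _ hXmeas
  have hUm : Measurable fun ω n => U n ω := measurable_pi_lambda _ hUmeas
  -- the fresh points
  have stepX : ∀ u v, ∫⁻ ω, G ((fun n => X n ω, u), (X (k + r) ω, X (k + r + 1) ω, v)) ∂μ =
      ∫⁻ ω, ∫⁻ y, ∫⁻ y', G ((fun n => X n ω, u), (y, y', v)) ∂lebesgueCube d ∂lebesgueCube d ∂μ := by
    intro u v
    -- The later point is resampled first, while the earlier one `k + r` still counts among the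
    -- first `k + r + 1` terms.
    rw [lintegral_resample (G := fun p => G ((p.1, u), (p.1 (k + r), p.2, v))) hXmeas hXindep
      (k + r + 1) (hG.comp (by fun_prop)) ?_, hXlaw]
    · rw [lintegral_resample (G := fun p => ∫⁻ y', G ((p.1, u), (p.2, y', v)) ∂lebesgueCube d)
        hXmeas hXindep (k + r) ?_ ?_, hXlaw]
      · refine Measurable.lintegral_prod_right' (f := fun p : ((ℕ → UnitCube d) × UnitCube d) ×
          UnitCube d => G ((p.1.1, u), (p.1.2, p.2, v))) (hG.comp (by fun_prop))
      · intro y y' e h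
        exact lintegral_congr fun _ => hdep _ _ _ _ _ h fun _ _ => rfl
    · intro y y' e h
      simp only
      rw [h (k + r) (by omega)]
      exact hdep _ _ _ _ _ (fun i hi => h i (by omega)) fun _ _ => rfl
  have hG2 : Measurable fun p : ((ℕ → UnitCube d) × (ℕ → ℝ)) × ℝ =>
      ∫⁻ y, ∫⁻ y', G (p.1, (y, y', p.2)) ∂lebesgueCube d ∂lebesgueCube d := by
    refine Measurable.lintegral_prod_right' (f := fun p : (((ℕ → UnitCube d) × (ℕ → ℝ)) × ℝ) ×
      UnitCube d => ∫⁻ y', G (p.1.1, (p.2, y', p.1.2)) ∂lebesgueCube d) ?_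
    exact Measurable.lintegral_prod_right' (f := fun p : ((((ℕ → UnitCube d) × (ℕ → ℝ)) × ℝ) ×
      UnitCube d) × UnitCube d => G (p.1.1.1, (p.1.2, p.2, p.1.1.2))) (hG.comp (by fun_prop))
  have stepU : ∀ x, ∫⁻ ω, ∫⁻ y, ∫⁻ y', G ((x, fun n => U n ω), (y, y', U k ω))
        ∂lebesgueCube d ∂lebesgueCube d ∂μ =
      ∫⁻ ω, ∫⁻ v, ∫⁻ y, ∫⁻ y', G ((x, fun n => U n ω), (y, y', v))
        ∂lebesgueCube d ∂lebesgueCube d ∂(volume.restrict (Set.Icc (0 : ℝ) 1)) ∂μ := by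
    intro x
    have hGx : Measurable fun p : (ℕ → ℝ) × ℝ => ∫⁻ y, ∫⁻ y', G ((x, p.1), (y, y', p.2))
        ∂lebesgueCube d ∂lebesgueCube d :=
      hG2.comp (f := fun p : (ℕ → ℝ) × ℝ => ((x, p.1), p.2)) (by fun_prop)
    rw [lintegral_resample hUmeas hUindep k hGx ?_, hUlaw]
    intro y y' e h
    exact lintegral_congr fun _ => lintegral_congr fun _ => hdep _ _ _ _ _ (fun _ _ => rfl) h
  have hG3 : Measurable fun p : (ℕ → UnitCube d) × (ℕ → ℝ) => ∫⁻ v,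
      ∫⁻ y, ∫⁻ y', G (p, (y, y', v)) ∂lebesgueCube d ∂lebesgueCube d ∂(volume.restrict (Set.Icc (0 : ℝ) 1)) :=
    hG2.lintegral_prod_right'
  -- Independence of the two sequences lets `U` run over a separate copy `ω'`; each sequence is
  -- resampled with the other frozen, and then the two copies are merged again.
  calc _ = ∫⁻ ω, G ((fun n => X n ω, fun n => U n ω), (X (k + r) ω, X (k + r + 1) ω, U k ω)) ∂μ := by
        refine lintegral_congr fun ω => ?_
        simp only [G]
        by_cases h : (thinningState f (fun n => X n ω) (fun n => U n ω) k).2 = r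
        · rw [if_pos h, if_pos h, thinningState_succ]
          simp only [h]
          split_ifs <;> simp [add_assoc]
        · rw [if_neg h, if_neg h]
    _ = ∫⁻ ω, ∫⁻ ω', G ((fun n => X n ω, fun n => U n ω'),
          (X (k + r) ω, X (k + r + 1) ω, U k ω')) ∂μ ∂μ :=
        lintegral_indepFun (G := fun p => G ((p.1, p.2), (p.1 (k + r), p.1 (k + r + 1), p.2 k)))
          hXm hUm hXU (hG.comp (by fun_prop))
    _ = ∫⁻ ω', ∫⁻ ω, G ((fun n => X n ω, fun n => U n ω'),
          (X (k + r) ω, X (k + r + 1) ω, U k ω')) ∂μ ∂μ :=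
        lintegral_lintegral_swap (hG.comp (by fun_prop)).aemeasurable
    _ = ∫⁻ ω', ∫⁻ ω, ∫⁻ y, ∫⁻ y', G ((fun n => X n ω, fun n => U n ω'), (y, y', U k ω'))
          ∂lebesgueCube d ∂lebesgueCube d ∂μ ∂μ :=
        lintegral_congr fun ω' => stepX _ _
    _ = ∫⁻ ω, ∫⁻ ω', ∫⁻ y, ∫⁻ y', G ((fun n => X n ω, fun n => U n ω'), (y, y', U k ω'))
          ∂lebesgueCube d ∂lebesgueCube d ∂μ ∂μ :=
        lintegral_lintegral_swap (hG2.comp (f := fun p : Ω × Ω =>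
          (((fun n => X n p.2), (fun n => U n p.1)), U k p.1)) (by fun_prop)).aemeasurable
    _ = ∫⁻ ω, ∫⁻ ω', ∫⁻ v, ∫⁻ y, ∫⁻ y',
          G ((fun n => X n ω, fun n => U n ω'), (y, y', v)) ∂lebesgueCube d ∂lebesgueCube d
            ∂(volume.restrict (Set.Icc (0 : ℝ) 1)) ∂μ ∂μ :=
        lintegral_congr fun ω => stepU _
    _ = ∫⁻ ω, ∫⁻ v, ∫⁻ y, ∫⁻ y',
          G ((fun n => X n ω, fun n => U n ω), (y, y', v)) ∂lebesgueCube d ∂lebesgueCube d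
            ∂(volume.restrict (Set.Icc (0 : ℝ) 1)) ∂μ :=
        (lintegral_indepFun (G := fun p : (ℕ → UnitCube d) × (ℕ → ℝ) => ∫⁻ v,
          ∫⁻ y, ∫⁻ y', G (p, (y, y', v)) ∂lebesgueCube d ∂lebesgueCube d ∂(volume.restrict (Set.Icc (0 : ℝ) 1))) hXm hUm hXU hG3).symm
    _ = _ := by
        refine lintegral_congr fun ω => ?_
        simp only [G]
        split_ifs with h
        · exact lintegral_keep_or_replace (f := f k _) ((hf k).comp measurable_prodMk_left)
            (hf01 k _) (φ := fun y => g (Fin.snoc _ y))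
            (hg.comp ((measurable_snoc k).comp measurable_prodMk_left))
        · simp

/-- The index of the offered point is random, so the expectation is split according to the number
`r` of earlier rejections; the density obtained on each piece does not depend on `r`. -/
lemma lintegral_next_point
    (hXmeas : ∀ n, Measurable (X n)) (hUmeas : ∀ n, Measurable (U n))
    (hXlaw : ∀ n, μ.map (X n) = lebesgueCube d)
    (hUlaw : ∀ n, μ.map (U n) = volume.restrict (Set.Icc (0 : ℝ) 1))
    (hXindep : iIndepFun X μ) (hUindep : iIndepFun U μ)
    (hXU : IndepFun (fun ω n => X n ω) (fun ω n => U n ω) μ)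
    (f : KeepRule d) (hf : ∀ k, Measurable fun p : (Fin k → UnitCube d) × UnitCube d => f k p.1 p.2)
    (hf01 : ∀ k z x, f k z x ∈ Set.Icc (0 : ℝ) 1)
    (k : ℕ) {g : (Fin (k + 1) → UnitCube d) → ℝ≥0∞} (hg : Measurable g) :
    ∫⁻ ω, g (thinningState f (fun n => X n ω) (fun n => U n ω) (k + 1)).1 ∂μ =
    ∫⁻ ω, ∫⁻ y, g (Fin.snoc (thinningState f (fun n => X n ω) (fun n => U n ω) k).1 y) *
        ENNReal.ofReal (f k (thinningState f (fun n => X n ω) (fun n => U n ω) k).1 y +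
          (1 - ∫ x, f k (thinningState f (fun n => X n ω) (fun n => U n ω) k).1 x ∂lebesgueCube d))
        ∂lebesgueCube d ∂μ := by
  have hXU' : Measurable fun ω => ((fun n => X n ω, fun n => U n ω) : (ℕ → UnitCube d) × (ℕ → ℝ)) :=
    (measurable_pi_lambda _ hXmeas).prodMk (measurable_pi_lambda _ hUmeas)
  have hst := fun k => (measurable_thinningState hf k).comp hXU'
  have hset : ∀ r, MeasurableSet
      {ω | (thinningState f (fun n => X n ω) (fun n => U n ω) k).2 = r} := fun r =>
    (measurable_snd.comp (hst k)) (measurableSet_singleton r)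
  have hsplit : ∀ F : Ω → ℝ≥0∞, Measurable F → ∫⁻ ω, F ω ∂μ = ∑' r : ℕ,
      ∫⁻ ω, (if (thinningState f (fun n => X n ω) (fun n => U n ω) k).2 = r then F ω else 0) ∂μ := by
    intro F hF
    rw [← lintegral_tsum]
    · refine lintegral_congr fun ω => ?_
      rw [tsum_ite_eq']
    · intro r
      exact (Measurable.ite (hset r) hF measurable_const).aemeasurable
  rw [hsplit (fun ω => g (thinningState f (fun n => X n ω) (fun n => U n ω) (k + 1)).1)
    (hg.comp (measurable_fst.comp (hst (k + 1)))), hsplit]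
  · exact tsum_congr fun r => lintegral_next_point_of_rejected_eq hXmeas hUmeas hXlaw hUlaw hXindep
      hUindep hXU f hf hf01 k r hg
  · have hI : Measurable fun z : Fin k → UnitCube d => ∫ x, f k z x ∂lebesgueCube d :=
      ((hf k).stronglyMeasurable.integral_prod_right').measurable
    have h1 : Measurable fun z : Fin k → UnitCube d => ∫⁻ y, g (Fin.snoc z y) *
        ENNReal.ofReal (f k z y + (1 - ∫ x, f k z x ∂lebesgueCube d)) ∂lebesgueCube d := by
      refine Measurable.lintegral_prod_right' (f := fun p : (Fin k → UnitCube d) × UnitCube d =>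
        g (Fin.snoc p.1 p.2) * ENNReal.ofReal (f k p.1 p.2 + (1 - ∫ x, f k p.1 x ∂lebesgueCube d))) ?_
      exact (hg.comp (measurable_snoc k)).mul
        ((hf k).add (measurable_const.sub (hI.comp measurable_fst))).ennreal_ofReal
    exact h1.comp (measurable_fst.comp (hst k))

end NextPoint

/-! ### Exponential moments of the Haar sums -/

/-- The constant `4 / 7` is chosen so that, after the density bound `3 / 2`, the quadratic term uses
only `6 / 7` of the drift. -/
lemma cosh_le_of_le_half {η : ℝ} (h0 : 0 ≤ η) (h1 : η ≤ 1 / 2) :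
    Real.cosh η - 1 ≤ 4 / 7 * η ^ 2 := by
  have h2 : Real.cosh η ≤ 1 / (1 - η ^ 2 / 2) :=
    (Real.cosh_le_exp_half_sq η).trans
      (Real.exp_bound_div_one_sub_of_interval (by positivity) (by nlinarith))
  have h3 : 1 / (1 - η ^ 2 / 2) ≤ 1 + 4 / 7 * η ^ 2 := by
    rw [div_le_iff₀ (by nlinarith)]
    nlinarith [mul_nonneg (sq_nonneg η) (show 0 ≤ 1 / 4 - η ^ 2 by nlinarith)]
  linarith

/-- The right side is `sinh |η s| = cosh (η s) - exp (-|η s|)`. This converts a drift by the sign of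
the sum into a contraction of `cosh`. -/
lemma cosh_sub_one_le_sign_mul_sinh {η : ℝ} (h0 : 0 ≤ η) (s : ℝ) :
    Real.cosh (η * s) - 1 ≤ Real.sign s * Real.sinh (η * s) := by
  rcases lt_trichotomy s 0 with hs | rfl | hs
  · rw [Real.sign_of_neg hs]
    have := Real.cosh_add_sinh (η * s)
    have h1 : Real.exp (η * s) ≤ 1 := Real.exp_le_one_iff.mpr (by nlinarith)
    linarith
  · simp
  · rw [Real.sign_of_pos hs]
    have := Real.cosh_sub_sinh (η * s)
    have h1 : Real.exp (-(η * s)) ≤ 1 := Real.exp_le_one_iff.mpr (by nlinarith)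
    linarith

lemma cosh_mul_add {η s t : ℝ} (ht : t = 1 ∨ t = -1 ∨ t = 0) :
    Real.cosh (η * (s + t)) = Real.cosh (η * s) + Real.cosh (η * s) * (Real.cosh η - 1) * (t * t) +
      Real.sinh (η * s) * Real.sinh η * t := by
  rcases ht with rfl | rfl | rfl
  · rw [mul_add, mul_one, Real.cosh_add]; ring
  · rw [mul_add, mul_neg_one, ← sub_eq_add_neg, Real.cosh_sub]; ring
  · simp

section Moments
variable {d : ℕ}

lemma haarDensity_nonneg (hd : 1 ≤ d) {β : ℝ} (hβ0 : 0 ≤ β) (hβ1 : β ≤ 1) (n : ℕ) {k : ℕ}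
    (z : Fin k → UnitCube d) (x : UnitCube d) : 0 ≤ haarDensity β n z x := by
  have := abs_le.mp (abs_haarDensity_sub_one_le hd hβ0 n z x)
  linarith

lemma haarDensity_le (hd : 1 ≤ d) {β : ℝ} (hβ0 : 0 ≤ β) (hβ1 : β ≤ 1) (n : ℕ) {k : ℕ}
    (z : Fin k → UnitCube d) (x : UnitCube d) : haarDensity β n z x ≤ 3 / 2 := by
  have := abs_le.mp (abs_haarDensity_sub_one_le hd hβ0 n z x)
  linarith

lemma measurable_haarDensity_right (β : ℝ) (n : ℕ) {k : ℕ} (z : Fin k → UnitCube d) :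
    Measurable (haarDensity β n z) := by
  have h : Measurable fun x : UnitCube d => (z, x) := measurable_prodMk_left
  have h' := (measurable_haarDensity β n k).comp h
  exact h'

lemma integrable_haarDensity_mul (hd : 1 ≤ d) {β : ℝ} (hβ0 : 0 ≤ β) (hβ1 : β ≤ 1) (n : ℕ) {k : ℕ}
    (z : Fin k → UnitCube d) {φ : UnitCube d → ℝ} (hφ : Measurable φ) (hb : ∀ x, |φ x| ≤ 1) :
    Integrable (fun x => haarDensity β n z x * φ x) (lebesgueCube d) := by
  refine Integrable.of_bound
    ((measurable_haarDensity_right β n z).mul hφ).aestronglyMeasurable (3 / 2)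
    (Eventually.of_forall fun x => ?_)
  rw [Real.norm_eq_abs, abs_mul, abs_of_nonneg (haarDensity_nonneg hd hβ0 hβ1 n z x)]
  have := haarDensity_le hd hβ0 hβ1 n z x
  have := haarDensity_nonneg hd hβ0 hβ1 n z x
  nlinarith [hb x, abs_nonneg (φ x)]

lemma integral_haarDensity_mul_sq_le (hd : 1 ≤ d) {β : ℝ} (hβ0 : 0 ≤ β) (hβ1 : β ≤ 1) (n : ℕ)
    {k : ℕ} (z : Fin k → UnitCube d) (m a : Fin d → ℕ) :
    ∫ x, haarDensity β n z x * (haar m a x * haar m a x) ∂lebesgueCube d ≤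
      3 / 2 * ∫ x, haar m a x * haar m a x ∂lebesgueCube d := by
  have hb : ∀ x, |haar m a x * haar m a x| ≤ 1 := fun x => by
    rw [abs_mul]; exact mul_le_one₀ (abs_haar_le_one m a x) (abs_nonneg _) (abs_haar_le_one m a x)
  have hm := (measurable_haar m a).mul (measurable_haar m a)
  rw [← integral_const_mul]
  refine integral_mono (integrable_haarDensity_mul hd hβ0 hβ1 n z hm hb)
    ((integrable_of_abs_le_one hm hb).const_mul _) fun x => ?_
  exact mul_le_mul_of_nonneg_right (haarDensity_le hd hβ0 hβ1 n z x) (mul_self_nonneg _)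

lemma integral_cosh_mul_haarDensity (hd : 1 ≤ d) {β : ℝ} (hβ0 : 0 ≤ β) (hβ1 : β ≤ 1) (n : ℕ) {k : ℕ}
    (z : Fin k → UnitCube d) (m a : Fin d → ℕ) (η s : ℝ) :
    Integrable (fun x => Real.cosh (η * (s + haar m a x)) * haarDensity β n z x) (lebesgueCube d) ∧
    ∫ x, Real.cosh (η * (s + haar m a x)) * haarDensity β n z x ∂lebesgueCube d =
      Real.cosh (η * s) + Real.cosh (η * s) * (Real.cosh η - 1) *
        ∫ x, haarDensity β n z x * (haar m a x * haar m a x) ∂lebesgueCube d +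
      Real.sinh (η * s) * Real.sinh η * ∫ x, haarDensity β n z x * haar m a x ∂lebesgueCube d := by
  have e : ∀ x, Real.cosh (η * (s + haar m a x)) * haarDensity β n z x =
      Real.cosh (η * s) * haarDensity β n z x + Real.cosh (η * s) * (Real.cosh η - 1) *
        (haarDensity β n z x * (haar m a x * haar m a x)) +
      Real.sinh (η * s) * Real.sinh η * (haarDensity β n z x * haar m a x) := by
    intro x
    rw [cosh_mul_add (haar_trichotomy x)]; ring
  have hb : ∀ x, |haar m a x * haar m a x| ≤ 1 := fun x => by
    rw [abs_mul]; exact mul_le_one₀ (abs_haar_le_one m a x) (abs_nonneg _) (abs_haar_le_one m a x)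
  have i1 : Integrable (haarDensity β n z) (lebesgueCube d) := by
    simpa using integrable_haarDensity_mul hd hβ0 hβ1 n z (φ := fun _ => 1) measurable_const (by simp)
  have i2 : Integrable (fun x => haarDensity β n z x * (haar m a x * haar m a x))
      (lebesgueCube d) := integrable_haarDensity_mul hd hβ0 hβ1 n z
    ((measurable_haar m a).mul (measurable_haar m a)) hb
  have i3 := integrable_haarDensity_mul hd hβ0 hβ1 n z (measurable_haar m a) (abs_haar_le_one m a)
  simp only [e]
  refine ⟨((i1.const_mul _).add (i2.const_mul _)).add (i3.const_mul _), ?_⟩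
  have i12 : Integrable (fun x => Real.cosh (η * s) * haarDensity β n z x +
    Real.cosh (η * s) * (Real.cosh η - 1) *
        (haarDensity β n z x * (haar m a x * haar m a x))) (lebesgueCube d) :=
    (i1.const_mul _).add (i2.const_mul _)
  rw [integral_add i12 (i3.const_mul _),
    integral_add (i1.const_mul _) (i2.const_mul _), integral_const_mul, integral_const_mul,
    integral_const_mul, integral_haarDensity, mul_one]

/-- One step of the walk before the Haar function is controlled. -/
lemma integral_cosh_le_of_lt (hd : 1 ≤ d) {β : ℝ} (hβ0 : 0 ≤ β) (hβ1 : β ≤ 1) {n : ℕ} {k : ℕ}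
    (z : Fin k → UnitCube d) {m a : Fin d → ℕ} (hm : Nat.log 2 n < ∑ i, m i) {η : ℝ} (h0 : 0 ≤ η)
    (h1 : η ≤ 1 / 2) (s : ℝ) :
    ∫ x, Real.cosh (η * (s + haar m a x)) * haarDensity β n z x ∂lebesgueCube d ≤
      (1 + 2 ^ d * ((2 : ℝ) ^ (∑ i, m i))⁻¹) * Real.cosh (η * s) := by
  rw [(integral_cosh_mul_haarDensity hd hβ0 hβ1 n z m a η s).2,
    integral_haarDensity_mul_haar_of_lt β z hm]
  have h2 := integral_haarDensity_mul_sq_le hd hβ0 hβ1 n z m a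
  have h3 := integral_haar_mul_self_le (m := m) (a := a)
  have h4 := cosh_le_of_le_half h0 h1
  have h5 := Real.one_le_cosh η
  have h6 := Real.cosh_pos (η * s)
  have h7 : 0 ≤ ∫ x, haarDensity β n z x * (haar m a x * haar m a x) ∂lebesgueCube d :=
    integral_nonneg fun x => mul_nonneg (haarDensity_nonneg hd hβ0 hβ1 n z x) (mul_self_nonneg _)
  set P := 2 ^ d * ((2 : ℝ) ^ (∑ i, m i))⁻¹
  set Q := ∫ x, haarDensity β n z x * (haar m a x * haar m a x) ∂lebesgueCube d
  have h8 : (Real.cosh η - 1) * Q ≤ 1 / 2 * (3 / 2 * P) := by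
    refine mul_le_mul (by nlinarith) (by linarith) h7 (by norm_num)
  have h9 : Real.cosh (η * s) * ((Real.cosh η - 1) * Q) ≤ Real.cosh (η * s) * P := by
    refine mul_le_mul_of_nonneg_left ?_ h6.le
    linarith
  nlinarith

/-- One step of the walk when the Haar function is controlled. -/
lemma integral_cosh_le_of_mem (hd : 1 ≤ d) {β : ℝ} (hβ0 : 0 ≤ β) (hβ1 : β ≤ 1) {n : ℕ} {k : ℕ}
    (z : Fin k → UnitCube d) {m a : Fin d → ℕ} (hm : m ∈ haarOrders d (Nat.log 2 n))
    (ha : a ∈ haarPositions m) {η : ℝ} (h0 : 0 ≤ η) (h1 : η ≤ 1 / 2)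
    (hη : η ≤ β / (2 * haarWeight d (Nat.log 2 n))) :
    ∫ x, Real.cosh (η * ((∑ i, haar m a (z i)) + haar m a x)) * haarDensity β n z x
        ∂lebesgueCube d ≤
      (1 - η * Real.sinh η * (∫ x, haar m a x * haar m a x ∂lebesgueCube d) / 7) *
          Real.cosh (η * ∑ i, haar m a (z i)) +
        η * Real.sinh η * ∫ x, haar m a x * haar m a x ∂lebesgueCube d := by
  rw [(integral_cosh_mul_haarDensity hd hβ0 hβ1 n z m a η _).2,
    integral_haarDensity_mul_haar β z hm ha]
  have h2 := integral_haarDensity_mul_sq_le hd hβ0 hβ1 n z m a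
  have h4 := cosh_le_of_le_half h0 h1
  have h5 := Real.one_le_cosh η
  set s := ∑ i, haar m a (z i)
  set ε := β / (2 * haarWeight d (Nat.log 2 n))
  have h6 := Real.cosh_pos (η * s)
  have h7 : 0 ≤ ∫ x, haarDensity β n z x * (haar m a x * haar m a x) ∂lebesgueCube d :=
    integral_nonneg fun x => mul_nonneg (haarDensity_nonneg hd hβ0 hβ1 n z x) (mul_self_nonneg _)
  have h8 : 0 ≤ ∫ x, haar m a x * haar m a x ∂lebesgueCube d :=
    integral_nonneg fun x => mul_self_nonneg _
  have h9 := cosh_sub_one_le_sign_mul_sinh h0 s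
  have h10 : η ≤ Real.sinh η := Real.self_le_sinh_iff.mpr h0
  set p := ∫ x, haar m a x * haar m a x ∂lebesgueCube d
  set Q := ∫ x, haarDensity β n z x * (haar m a x * haar m a x) ∂lebesgueCube d
  have h11 : 0 ≤ Real.sinh η := h0.trans h10
  have h12 : (Real.cosh η - 1) * Q ≤ (4 / 7 * (η * Real.sinh η)) * (3 / 2 * p) := by
    refine mul_le_mul (by nlinarith) h2 h7 (by positivity)
  have h13 := mul_le_mul_of_nonneg_left h12 h6.le
  have hc1 := Real.one_le_cosh (η * s)
  -- The true drift `ε` may be stronger than `η`; only the part `η` is used. It removes `δ (cosh -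
  -- 1)` with `δ = η sinh η · p`, while `h13` adds at most `(6 / 7) δ cosh`.
  have h14 : η * p * Real.sinh η * (Real.cosh (η * s) - 1) ≤
      ε * p * Real.sinh η * (Real.sign s * Real.sinh (η * s)) :=
    mul_le_mul (by gcongr) h9 (by linarith) (by positivity)
  nlinarith

variable {Ω : Type*} [MeasurableSpace Ω] {μ : Measure Ω} [IsProbabilityMeasure μ]
  {X : ℕ → Ω → UnitCube d} {U : ℕ → Ω → ℝ}

/-- For the Haar strategy the rejection probability is `β / 2`, which restores the shift in its
definition: the next point has density `haarDensity`. -/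
lemma lintegral_cosh_succ (hd : 1 ≤ d) {β : ℝ} (hβ0 : 0 ≤ β) (hβ1 : β ≤ 1)
    (hXmeas : ∀ n, Measurable (X n)) (hUmeas : ∀ n, Measurable (U n))
    (hXlaw : ∀ n, μ.map (X n) = lebesgueCube d)
    (hUlaw : ∀ n, μ.map (U n) = volume.restrict (Set.Icc (0 : ℝ) 1))
    (hXindep : iIndepFun X μ) (hUindep : iIndepFun U μ)
    (hXU : IndepFun (fun ω n => X n ω) (fun ω n => U n ω) μ) (m a : Fin d → ℕ) (η : ℝ) (k : ℕ) :
    ∫⁻ ω, ENNReal.ofReal (Real.cosh (η * ∑ i, haar m a ((thinningState (haarStrategy d β)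
      (fun n => X n ω) (fun n => U n ω) (k + 1)).1 i))) ∂μ =
    ∫⁻ ω, ENNReal.ofReal (∫ x, Real.cosh (η * ((∑ i, haar m a ((thinningState (haarStrategy d β)
      (fun n => X n ω) (fun n => U n ω) k).1 i)) + haar m a x)) *
      haarDensity β (k + 1) (thinningState (haarStrategy d β) (fun n => X n ω) (fun n => U n ω) k).1 x
        ∂lebesgueCube d) ∂μ := by
  have hT := isThinningStrategy_haarStrategy hd hβ0 hβ1
  have hg : Measurable fun z : Fin (k + 1) → UnitCube d =>
      ENNReal.ofReal (Real.cosh (η * ∑ i, haar m a (z i))) :=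
    (Real.measurable_cosh.comp ((Finset.measurable_sum _ fun i _ =>
      (measurable_haar m a).comp (measurable_pi_apply i)).const_mul η)).ennreal_ofReal
  rw [lintegral_next_point hXmeas hUmeas hXlaw hUlaw hXindep hUindep hXU _ hT.measurable hT.mem_Icc
    k hg]
  refine lintegral_congr fun ω => ?_
  generalize (thinningState (haarStrategy d β) (fun n => X n ω) (fun n => U n ω) k).1 = z
  rw [ofReal_integral_eq_lintegral_ofReal
    (integral_cosh_mul_haarDensity hd hβ0 hβ1 (k + 1) z m a η _).1
    (Eventually.of_forall fun x => mul_nonneg (Real.cosh_pos _).le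
      (haarDensity_nonneg hd hβ0 hβ1 _ z x))]
  have i1 : Integrable (haarDensity β (k + 1) z) (lebesgueCube d) := by
    simpa using integrable_haarDensity_mul hd hβ0 hβ1 (k + 1) z (φ := fun _ => 1) measurable_const
      (by simp)
  have hI : ∫ x, haarStrategy d β k z x ∂lebesgueCube d = 1 - β / 2 := by
    unfold haarStrategy
    rw [integral_sub i1 (integrable_const _), integral_haarDensity]
    simp
  refine lintegral_congr fun x => ?_
  rw [hI, ENNReal.ofReal_mul (Real.cosh_pos _).le, Fin.sum_univ_castSucc]
  simp only [Fin.snoc_castSucc, Fin.snoc_last, haarStrategy]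
  congr 2
  ring

/-- The parameter `η` is frozen at the final time `n`. Since `W` increases, the drift at every
earlier controlled time is at least as strong as the one for `n`, so a single exponential moment can
be followed through all rounds. -/
lemma lintegral_cosh_le (hd : 1 ≤ d) {β : ℝ} (hβ0 : 0 ≤ β) (hβ1 : β ≤ 1)
    (hXmeas : ∀ n, Measurable (X n)) (hUmeas : ∀ n, Measurable (U n))
    (hXlaw : ∀ n, μ.map (X n) = lebesgueCube d)
    (hUlaw : ∀ n, μ.map (U n) = volume.restrict (Set.Icc (0 : ℝ) 1))
    (hXindep : iIndepFun X μ) (hUindep : iIndepFun U μ)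
    (hXU : IndepFun (fun ω n => X n ω) (fun ω n => U n ω) μ) {m a : Fin d → ℕ} {n : ℕ}
    (hm : m ∈ haarOrders d (Nat.log 2 n)) (ha : a ∈ haarPositions m) :
    ∫⁻ ω, ENNReal.ofReal (Real.cosh (β / (2 * haarWeight d (Nat.log 2 n)) *
      ∑ i, haar m a ((thinningState (haarStrategy d β)
        (fun n => X n ω) (fun n => U n ω) n).1 i))) ∂μ ≤ ENNReal.ofReal (Real.exp (2 ^ d)) := by
  set η := β / (2 * haarWeight d (Nat.log 2 n)) with hη
  obtain ⟨hm1, hm2⟩ := mem_haarOrders.mp hm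
  have hW : 1 ≤ haarWeight d (Nat.log 2 n) := one_le_haarWeight hd (hm1.trans hm2)
  have hW' : (1 : ℝ) ≤ haarWeight d (Nat.log 2 n) := by exact_mod_cast hW
  have h0 : 0 ≤ η := by positivity
  have h1 : η ≤ 1 / 2 := by
    rw [hη, div_le_iff₀ (by positivity)]; linarith
  set p := ∫ x, haar m a x * haar m a x ∂lebesgueCube d with hp
  have hp0 : 0 ≤ p := integral_nonneg fun x => mul_self_nonneg _
  have hp1 : p ≤ 1 := by
    have hb : ∀ x, |haar m a x * haar m a x| ≤ 1 := fun x => by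
      rw [abs_mul]; exact mul_le_one₀ (abs_haar_le_one m a x) (abs_nonneg _) (abs_haar_le_one m a x)
    calc p ≤ ∫ x, (1 : ℝ) ∂lebesgueCube d :=
          integral_mono (integrable_of_abs_le_one ((measurable_haar m a).mul (measurable_haar m a)) hb)
            (integrable_const _) fun x => (le_abs_self _).trans (hb x)
      _ = 1 := by simp
  set M := ∑ i, m i with hM
  set P : ℝ := 2 ^ d * ((2 : ℝ) ^ M)⁻¹ with hP
  have hP0 : 0 ≤ P := by positivity
  set E : ℕ → ℝ≥0∞ := fun k => ∫⁻ ω, ENNReal.ofReal (Real.cosh (η *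
      ∑ i, haar m a ((thinningState (haarStrategy d β)
        (fun n => X n ω) (fun n => U n ω) k).1 i))) ∂μ with hE
  have hsucc := lintegral_cosh_succ hd hβ0 hβ1 hXmeas hUmeas hXlaw hUlaw hXindep hUindep hXU m a η
  have hT := isThinningStrategy_haarStrategy hd hβ0 hβ1
  have hmeas : ∀ k, Measurable fun ω => ENNReal.ofReal (Real.cosh (η *
      ∑ i, haar m a ((thinningState (haarStrategy d β)
        (fun n => X n ω) (fun n => U n ω) k).1 i))) := by
    intro k
    have hst := (measurable_thinningState hT.measurable k).comp
      ((measurable_pi_lambda _ hXmeas).prodMk (measurable_pi_lambda _ hUmeas))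
    exact (Real.measurable_cosh.comp ((Finset.measurable_sum _ fun i _ => (measurable_haar m a).comp
      ((measurable_pi_apply i).comp (measurable_fst.comp hst))).const_mul η)).ennreal_ofReal
  -- Until the number of points reaches `2 ^ M` the function is beyond the controlled orders and its
  -- sum has no drift.
  have phase1 : ∀ k < 2 ^ M, E k ≤ ENNReal.ofReal ((1 + P) ^ k) := by
    intro k
    induction k with
    | zero => intro _; simp [hE]
    | succ k ih =>
      intro hk
      have hlog : Nat.log 2 (k + 1) < M := Nat.log_lt_of_lt_pow (by omega) hk
      calc E (k + 1) ≤ ∫⁻ ω, ENNReal.ofReal (1 + P) * ENNReal.ofReal (Real.cosh (η *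
            ∑ i, haar m a ((thinningState (haarStrategy d β)
              (fun n => X n ω) (fun n => U n ω) k).1 i))) ∂μ := by
            simp only [hE]
            rw [hsucc k]
            refine lintegral_mono fun ω => ?_
            rw [← ENNReal.ofReal_mul (by positivity)]
            exact ENNReal.ofReal_le_ofReal (integral_cosh_le_of_lt hd hβ0 hβ1 _ hlog h0 h1 _)
        _ = ENNReal.ofReal (1 + P) * E k := lintegral_const_mul _ (hmeas k)
        _ ≤ ENNReal.ofReal (1 + P) * ENNReal.ofReal ((1 + P) ^ k) := by
            gcongr; exact ih (by omega)
        _ = _ := by rw [← ENNReal.ofReal_mul (by positivity), pow_succ']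
  -- The fixed point of `E ↦ (1 - δ / 7) E + δ` is `7`, so any bound that is at least `7` persists
  -- in the controlled phase.
  have hK : (7 : ℝ) ≤ Real.exp (2 ^ d) := by
    have h2 : (2 : ℝ) ≤ 2 ^ d := by
      calc (2 : ℝ) = 2 ^ 1 := (pow_one _).symm
        _ ≤ 2 ^ d := pow_le_pow_right₀ (by norm_num) hd
    calc (7 : ℝ) ≤ Real.exp 1 * Real.exp 1 := by nlinarith [Real.exp_one_gt_d9]
      _ = Real.exp 2 := by rw [← Real.exp_add]; norm_num
      _ ≤ _ := Real.exp_le_exp.mpr h2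
  set K := Real.exp (2 ^ d)
  have start : ∀ k < 2 ^ M, E k ≤ ENNReal.ofReal K := by
    intro k hk
    refine (phase1 k hk).trans (ENNReal.ofReal_le_ofReal ?_)
    calc (1 + P) ^ k ≤ Real.exp P ^ k := by
          gcongr; rw [add_comm]; exact Real.add_one_le_exp P
      _ = Real.exp (k * P) := (Real.exp_nat_mul P k).symm
      _ ≤ K := by
          refine Real.exp_le_exp.mpr ?_
          have hk' : (k : ℝ) ≤ 2 ^ M := by exact_mod_cast hk.le
          calc (k : ℝ) * P ≤ 2 ^ M * P := by gcongr
            _ = 2 ^ d := by rw [hP]; field_simp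
  have hsinh0 : 0 ≤ Real.sinh η := Real.sinh_nonneg_iff.mpr h0
  have hsinh : Real.sinh η ≤ 2 := by
    have := cosh_le_of_le_half h0 h1
    have := Real.sinh_lt_cosh η
    nlinarith
  set δ := η * Real.sinh η * p with hδ
  have hδ0 : 0 ≤ δ := by positivity
  have hδ1 : δ ≤ 1 := by
    calc δ ≤ (1 / 2 * 2) * 1 := by rw [hδ]; gcongr
      _ = 1 := by norm_num
  have hall : ∀ k ≤ n, E k ≤ ENNReal.ofReal K := by
    intro k
    induction k with
    | zero => intro _; exact start 0 (by positivity)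
    | succ k ih =>
      intro hk
      by_cases hkM : k + 1 < 2 ^ M
      · exact start _ hkM
      have hmk : m ∈ haarOrders d (Nat.log 2 (k + 1)) :=
        mem_haarOrders.mpr ⟨hm1, Nat.le_log_of_pow_le (by norm_num) (not_lt.mp hkM)⟩
      have hWk : 1 ≤ haarWeight d (Nat.log 2 (k + 1)) :=
        one_le_haarWeight hd ((mem_haarOrders.mp hmk).1.trans (mem_haarOrders.mp hmk).2)
      have hWk' : (1 : ℝ) ≤ haarWeight d (Nat.log 2 (k + 1)) := by exact_mod_cast hWk
      have hWW : (haarWeight d (Nat.log 2 (k + 1)) : ℝ) ≤ haarWeight d (Nat.log 2 n) := by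
        exact_mod_cast haarWeight_mono (Nat.log_mono_right hk)
      have hηk : η ≤ β / (2 * haarWeight d (Nat.log 2 (k + 1))) := by
        rw [hη]; gcongr
      calc E (k + 1) ≤ ∫⁻ ω, (ENNReal.ofReal (1 - δ / 7) * ENNReal.ofReal (Real.cosh (η *
            ∑ i, haar m a ((thinningState (haarStrategy d β)
              (fun n => X n ω) (fun n => U n ω) k).1 i))) + ENNReal.ofReal δ) ∂μ := by
            simp only [hE]
            rw [hsucc k]
            refine lintegral_mono fun ω => ?_
            simp only
            rw [← ENNReal.ofReal_mul (by linarith), ← ENNReal.ofReal_add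
              (mul_nonneg (by linarith) (Real.cosh_pos _).le) hδ0]
            exact ENNReal.ofReal_le_ofReal
              (integral_cosh_le_of_mem hd hβ0 hβ1 _ hmk ha h0 h1 hηk)
        _ = ENNReal.ofReal (1 - δ / 7) * E k + ENNReal.ofReal δ := by
            rw [lintegral_add_right _ measurable_const, lintegral_const_mul _ (hmeas k)]
            simp [hE]
        _ ≤ ENNReal.ofReal (1 - δ / 7) * ENNReal.ofReal K + ENNReal.ofReal δ := by
            gcongr; exact ih (by omega)
        _ = ENNReal.ofReal ((1 - δ / 7) * K + δ) := by
            rw [← ENNReal.ofReal_mul (by linarith), ← ENNReal.ofReal_add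
              (mul_nonneg (by linarith) (by linarith)) hδ0]
        _ ≤ ENNReal.ofReal K := ENNReal.ofReal_le_ofReal (by nlinarith)
  exact hall n le_rfl

end Moments

/-! ### The signed discrepancy functional -/

section Discrepancy
variable {d n : ℕ}

/-- The integral of `f` with respect to the counting measure of the points `z` minus `n` times
Lebesgue measure. -/
noncomputable def signedDisc (z : Fin n → UnitCube d) (f : UnitCube d → ℝ) : ℝ :=
  ∑ i, f (z i) - n * ∫ x, f x ∂lebesgueCube d

variable (z : Fin n → UnitCube d)

lemma signedDisc_add {f g : UnitCube d → ℝ} (hf : Integrable f (lebesgueCube d))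
    (hg : Integrable g (lebesgueCube d)) :
    signedDisc z (fun x => f x + g x) = signedDisc z f + signedDisc z g := by
  unfold signedDisc
  rw [integral_add hf hg, Finset.sum_add_distrib]; ring

lemma signedDisc_sub {f g : UnitCube d → ℝ} (hf : Integrable f (lebesgueCube d))
    (hg : Integrable g (lebesgueCube d)) :
    signedDisc z (fun x => f x - g x) = signedDisc z f - signedDisc z g := by
  unfold signedDisc
  rw [integral_sub hf hg, Finset.sum_sub_distrib]; ring

lemma signedDisc_const_mul (c : ℝ) (f : UnitCube d → ℝ) :
    signedDisc z (fun x => c * f x) = c * signedDisc z f := by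
  unfold signedDisc
  rw [integral_const_mul, ← Finset.mul_sum]; ring

lemma signedDisc_sum {ι : Type*} (s : Finset ι) {f : ι → UnitCube d → ℝ}
    (hf : ∀ i ∈ s, Integrable (f i) (lebesgueCube d)) :
    signedDisc z (fun x => ∑ i ∈ s, f i x) = ∑ i ∈ s, signedDisc z (f i) := by
  unfold signedDisc
  rw [integral_finsetSum s hf, Finset.sum_comm, Finset.sum_sub_distrib, Finset.mul_sum]

/-- The points and the integral are estimated separately by those of `g`; replacing the sum over the
points by the signed discrepancy costs a second copy of `n ∫ g`. -/
lemma abs_signedDisc_le {f g : UnitCube d → ℝ} (hg : Integrable g (lebesgueCube d))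
    (hfg : ∀ x, |f x| ≤ g x) :
    |signedDisc z f| ≤ |signedDisc z g| + 2 * (n * ∫ x, g x ∂lebesgueCube d) := by
  have h1 : |∑ i, f (z i)| ≤ ∑ i, g (z i) :=
    (Finset.abs_sum_le_sum_abs _ _).trans (Finset.sum_le_sum fun i _ => hfg _)
  have h2 : |∫ x, f x ∂lebesgueCube d| ≤ ∫ x, g x ∂lebesgueCube d :=
    norm_integral_le_of_norm_le (f := f) hg (Eventually.of_forall hfg)
  have h3 : |signedDisc z f| ≤ ∑ i, g (z i) + n * ∫ x, g x ∂lebesgueCube d := by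
    unfold signedDisc
    refine (abs_sub _ _).trans (add_le_add h1 ?_)
    rw [abs_mul, Nat.abs_cast]
    gcongr
  have h4 := le_abs_self (signedDisc z g)
  have h5 : signedDisc z g = ∑ i, g (z i) - n * ∫ x, g x ∂lebesgueCube d := rfl
  linarith

/-! ### Varying one coordinate of a product -/

/-- The product over the coordinates of the functions `G i`, with `G j` replaced by `f`. -/
noncomputable def slice (G : Fin d → Set.Ico (0 : ℝ) 1 → ℝ) (j : Fin d) (f : Set.Ico (0 : ℝ) 1 → ℝ)
    (x : UnitCube d) : ℝ :=
  f (x j) * ∏ i ∈ Finset.univ.erase j, G i (x i)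

lemma prod_coord_eq_slice {F G : Fin d → Set.Ico (0 : ℝ) 1 → ℝ} {j : Fin d}
    {f : Set.Ico (0 : ℝ) 1 → ℝ} (hj : F j = f) (h : ∀ i, i ≠ j → F i = G i) :
    (fun x : UnitCube d => ∏ i, F i (x i)) = slice G j f := by
  funext x
  rw [slice, ← Finset.mul_prod_erase _ _ (Finset.mem_univ j), hj]
  congr 1
  exact Finset.prod_congr rfl fun i hi => by rw [h i (Finset.ne_of_mem_erase hi)]

variable {G : Fin d → Set.Ico (0 : ℝ) 1 → ℝ} {j : Fin d}

lemma integrable_slice (hG : ∀ i, Measurable (G i)) (hG1 : ∀ i x, |G i x| ≤ 1)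
    {f : Set.Ico (0 : ℝ) 1 → ℝ} (hf : Measurable f) (hf1 : ∀ x, |f x| ≤ 1) :
    Integrable (slice G j f) (lebesgueCube d) := by
  refine integrable_of_abs_le_one
    ((hf.comp (measurable_pi_apply j)).mul (measurable_prod_coord hG _)) fun x => ?_
  rw [slice, abs_mul]
  exact mul_le_one₀ (hf1 _) (abs_nonneg _) (abs_prod_coord_le_one hG1 _ x)

/-- Bounds for Haar functions in one coordinate carry over to dyadic intervals. -/
lemma abs_signedDisc_slice_dyadicInd_le (hG : ∀ i, Measurable (G i)) (hG1 : ∀ i x, |G i x| ≤ 1)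
    {M : ℝ} (L : ℕ) (h : ∀ m ≤ L, ∀ a, |signedDisc z (slice G j (haarOne m a))| ≤ M) (a : ℕ) :
    |signedDisc z (slice G j (dyadicInd L a))| ≤ M := by
  induction L generalizing a with
  | zero => rw [dyadicInd_zero_eq_haarOne]; exact h 0 le_rfl a
  | succ L ih =>
    have h1 := ih (fun m hm => h m (by omega)) (a / 2)
    have h2 := h (L + 1) le_rfl (a / 2)
    have e : slice G j (dyadicInd (L + 1) a) = fun x => 2⁻¹ * slice G j (dyadicInd L (a / 2)) x +
        (if Even a then 2⁻¹ else -2⁻¹) * slice G j (haarOne (L + 1) (a / 2)) x := by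
      funext x
      simp only [slice]
      rw [dyadicInd_succ]; ring
    rw [e, signedDisc_add z
      ((integrable_slice hG hG1 (measurable_dyadicInd _ _) (abs_dyadicInd_le_one _ _)).const_mul _)
      ((integrable_slice hG hG1 (measurable_haarOne _ _) (abs_haarOne_le_one _ _)).const_mul _),
      signedDisc_const_mul, signedDisc_const_mul]
    rw [abs_le] at h1 h2 ⊢
    split_ifs <;> constructor <;> linarith

/-- If the Haar functions of order at most `h` have small signed discrepancy, so have the dyadic
boxes of volume at least `2 ^ (-h)`. -/
lemma abs_signedDisc_dyadic_le {h : ℕ} {M : ℝ}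
    (hM : ∀ m a : Fin d → ℕ, ∑ i, m i ≤ h → |signedDisc z (haar m a)| ≤ M)
    (l a : Fin d → ℕ) (hl : ∑ i, l i ≤ h) :
    |signedDisc z (fun x => ∏ i, dyadicInd (l i) (a i) (x i))| ≤ M := by
  -- Coordinates are converted from Haar functions to intervals one at a time; the set `s` holds
  -- those already converted.
  have key : ∀ s : Finset (Fin d), ∀ l a : Fin d → ℕ, ∑ i, l i ≤ h → |signedDisc z (fun x =>
      ∏ i, (if i ∈ s then dyadicInd (l i) (a i) else haarOne (l i) (a i)) (x i))| ≤ M := by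
    intro s
    induction s using Finset.induction_on with
    | empty =>
      intro l a hl
      simp only [Finset.notMem_empty, if_false]
      exact hM l a hl
    | insert j s hj ih =>
      intro l a hl
      rw [prod_coord_eq_slice (j := j) (f := dyadicInd (l j) (a j))
        (G := fun i => if i ∈ s then dyadicInd (l i) (a i) else haarOne (l i) (a i))
        (by simp) (fun i hi => by simp [hi])]
      refine abs_signedDisc_slice_dyadicInd_le z ?_ ?_ _ ?_ _
      · intro i; split_ifs
        · exact measurable_dyadicInd _ _
        · exact measurable_haarOne _ _
      · intro i; split_ifs
        · exact abs_dyadicInd_le_one _ _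
        · exact abs_haarOne_le_one _ _
      · intro m hm b
        have := ih (Function.update l j m) (Function.update a j b) (le_trans
          (Finset.sum_le_sum fun i _ => by
            by_cases hi : i = j
            · subst hi; simpa using hm
            · simp [hi]) hl)
        rwa [prod_coord_eq_slice (j := j) (f := haarOne m b)
          (G := fun i => if i ∈ s then dyadicInd (l i) (a i) else haarOne (l i) (a i))
          (by simp [hj]) (fun i hi => by simp [hi])] at this
  simpa using key Finset.univ l a hl

/-! ### Binary decomposition of intervals and boxes -/

/-- The indicator of `[0, b)`. -/
noncomputable def belowInd (b : ℝ) (x : Set.Ico (0 : ℝ) 1) : ℝ := if (x : ℝ) < b then 1 else 0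

lemma measurable_belowInd (b : ℝ) : Measurable (belowInd b) :=
  Measurable.ite (measurableSet_lt measurable_subtype_coe measurable_const) measurable_const
    measurable_const

lemma abs_belowInd_le_one (b : ℝ) (x : Set.Ico (0 : ℝ) 1) : |belowInd b x| ≤ 1 := by
  unfold belowInd; split_ifs <;> norm_num

/-- The dyadic interval of length `2 ^ (-l)` in the binary decomposition of `[0, b)`, if there is
one. -/
noncomputable def binaryInd (b : ℝ) (l : ℕ) (x : Set.Ico (0 : ℝ) 1) : ℝ :=
  if Odd ⌊b * 2 ^ l⌋₊ then dyadicInd l (⌊b * 2 ^ l⌋₊ - 1) x else 0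

lemma measurable_binaryInd (b : ℝ) (l : ℕ) : Measurable (binaryInd b l) := by
  unfold binaryInd
  split_ifs
  · exact measurable_dyadicInd _ _
  · exact measurable_const

lemma abs_binaryInd_le_one (b : ℝ) (l : ℕ) (x : Set.Ico (0 : ℝ) 1) : |binaryInd b l x| ≤ 1 := by
  unfold binaryInd
  split_ifs
  · exact abs_dyadicInd_le_one _ _ _
  · simp

/-- The prefix `[0, ⌊b 2^K⌋ / 2^K)` gains, at each level where the new binary digit of `b` is `1`,
the cell just before its right end. -/
lemma sum_binaryInd {b : ℝ} (hb : b ≤ 1) (K : ℕ) (x : Set.Ico (0 : ℝ) 1) :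
    ∑ l ∈ Finset.range (K + 1), binaryInd b l x = if dyadicCell K x < ⌊b * 2 ^ K⌋₊ then 1 else 0 := by
  induction K with
  | zero =>
    have h1 : ⌊b * 2 ^ 0⌋₊ ≤ 1 := Nat.floor_le_of_le (by simpa using hb)
    rw [zero_add, Finset.sum_range_one]
    simp only [binaryInd, dyadicInd, dyadicCell_zero, Nat.odd_iff]
    split_ifs <;> first | omega | rfl
  | succ K ih =>
    rw [Finset.sum_range_succ, ih]
    have h1 := floor_mul_two_pow_succ b K
    have h2 := dyadicCell_succ_div K x
    simp only [binaryInd, dyadicInd, Nat.odd_iff]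
    split_ifs <;> first | omega | norm_num

lemma abs_belowInd_sub_sum_binaryInd_le {b : ℝ} (hb0 : 0 ≤ b) (hb : b ≤ 1) (K : ℕ)
    (x : Set.Ico (0 : ℝ) 1) :
    |belowInd b x - ∑ l ∈ Finset.range (K + 1), binaryInd b l x| ≤ dyadicInd K ⌊b * 2 ^ K⌋₊ x := by
  rw [sum_binaryInd hb]
  have h2 : (0 : ℝ) < 2 ^ K := by positivity
  have hx : dyadicCell K x < ⌊b * 2 ^ K⌋₊ → (x : ℝ) < b := by
    intro h
    have h1 : (x : ℝ) * 2 ^ K < dyadicCell K x + 1 := Nat.lt_floor_add_one _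
    have h3 : (⌊b * 2 ^ K⌋₊ : ℝ) ≤ b * 2 ^ K := Nat.floor_le (by positivity)
    have h4 : (dyadicCell K x : ℝ) + 1 ≤ ⌊b * 2 ^ K⌋₊ := by exact_mod_cast h
    exact lt_of_mul_lt_mul_right (by linarith) h2.le
  have hx' : (x : ℝ) < b → dyadicCell K x ≤ ⌊b * 2 ^ K⌋₊ := fun h =>
    Nat.floor_le_floor (mul_le_mul_of_nonneg_right h.le h2.le)
  unfold belowInd dyadicInd
  by_cases h : (x : ℝ) < b
  · have := hx' h
    rw [if_pos h]
    split_ifs <;> first | omega | norm_num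
  · have : ¬ dyadicCell K x < ⌊b * 2 ^ K⌋₊ := fun h' => h (hx h')
    rw [if_neg h, if_neg this]
    split_ifs <;> norm_num

lemma abs_signedDisc_slice_belowInd_le (hG : ∀ i, Measurable (G i)) (hG1 : ∀ i x, |G i x| ≤ 1)
    (K : ℕ) {C : ℕ → ℝ} {R : ℝ}
    (hC : ∀ l ≤ K, ∀ a, |signedDisc z (slice G j (dyadicInd l a))| ≤ C l)
    (hR : ∀ r : Set.Ico (0 : ℝ) 1 → ℝ, ∀ a, (∀ x, |r x| ≤ dyadicInd K a x) →
      |signedDisc z (slice G j r)| ≤ R)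
    {b : ℝ} (hb0 : 0 ≤ b) (hb : b ≤ 1) :
    |signedDisc z (slice G j (belowInd b))| ≤ ∑ l ∈ Finset.range (K + 1), C l + R := by
  set r : Set.Ico (0 : ℝ) 1 → ℝ := fun x =>
    belowInd b x - ∑ l ∈ Finset.range (K + 1), binaryInd b l x with hr
  have hr1 := abs_belowInd_sub_sum_binaryInd_le hb0 hb K
  have hrm : Measurable r :=
    (measurable_belowInd b).sub (Finset.measurable_sum _ fun l _ => measurable_binaryInd b l)
  have hi : ∀ l, Integrable (slice G j (binaryInd b l)) (lebesgueCube d) := fun l =>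
    integrable_slice hG hG1 (measurable_binaryInd b l) (abs_binaryInd_le_one b l)
  have e : slice G j (belowInd b) = fun x =>
      (∑ l ∈ Finset.range (K + 1), slice G j (binaryInd b l) x) + slice G j r x := by
    funext x
    simp only [slice, hr]
    rw [← Finset.sum_mul]; ring
  rw [e, signedDisc_add z (integrable_finsetSum _ fun l _ => hi l)
    (integrable_slice hG hG1 hrm fun x => (hr1 x).trans (dyadicInd_le_one _ _ _)),
    signedDisc_sum z _ fun l _ => hi l]
  refine (abs_add_le _ _).trans (add_le_add ((Finset.abs_sum_le_sum_abs _ _).trans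
    (Finset.sum_le_sum fun l hl => ?_)) (hR r _ hr1))
  have hlK : l ≤ K := by simpa [Nat.lt_succ_iff] using hl
  by_cases ho : Odd ⌊b * 2 ^ l⌋₊
  · have : binaryInd b l = dyadicInd l (⌊b * 2 ^ l⌋₊ - 1) := by
      funext x; simp [binaryInd, ho]
    rw [this]; exact hC l hlK _
  · have : slice G j (binaryInd b l) = fun _ => 0 := by
      funext x; simp [slice, binaryInd, ho]
    rw [this]
    simpa [signedDisc] using (abs_nonneg _).trans (hC l hlK 0)

/-- The indicator of `[a, b)`, for `a ≤ b`. -/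
noncomputable def intervalInd (a b : ℝ) (x : Set.Ico (0 : ℝ) 1) : ℝ := belowInd b x - belowInd a x

lemma intervalInd_eq {a b : ℝ} (hab : a ≤ b) (x : Set.Ico (0 : ℝ) 1) :
    intervalInd a b x = if a ≤ (x : ℝ) ∧ (x : ℝ) < b then 1 else 0 := by
  unfold intervalInd belowInd
  by_cases h1 : (x : ℝ) < a
  · rw [if_pos h1, if_pos (h1.trans_le hab), if_neg (fun h => absurd h.1 (not_le.mpr h1)), sub_self]
  · rw [if_neg h1, sub_zero]
    simp [not_lt.mp h1]

lemma measurable_intervalInd (a b : ℝ) : Measurable (intervalInd a b) :=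
  (measurable_belowInd b).sub (measurable_belowInd a)

lemma abs_intervalInd_le_one (a b : ℝ) (x : Set.Ico (0 : ℝ) 1) : |intervalInd a b x| ≤ 1 := by
  unfold intervalInd belowInd; split_ifs <;> norm_num

lemma abs_signedDisc_slice_intervalInd_le (hG : ∀ i, Measurable (G i)) (hG1 : ∀ i x, |G i x| ≤ 1)
    (K : ℕ) {C : ℕ → ℝ} {R : ℝ}
    (hC : ∀ l ≤ K, ∀ a, |signedDisc z (slice G j (dyadicInd l a))| ≤ C l)
    (hR : ∀ r : Set.Ico (0 : ℝ) 1 → ℝ, ∀ a, (∀ x, |r x| ≤ dyadicInd K a x) →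
      |signedDisc z (slice G j r)| ≤ R)
    {a b : ℝ} (ha0 : 0 ≤ a) (hab : a ≤ b) (hb : b ≤ 1) :
    |signedDisc z (slice G j (intervalInd a b))| ≤
      2 * (∑ l ∈ Finset.range (K + 1), C l + R) := by
  have e : slice G j (intervalInd a b) = fun x =>
      slice G j (belowInd b) x - slice G j (belowInd a) x := by
    funext x; simp only [slice, intervalInd]; ring
  rw [e, signedDisc_sub z
    (integrable_slice hG hG1 (measurable_belowInd b) (abs_belowInd_le_one b))
    (integrable_slice hG hG1 (measurable_belowInd a) (abs_belowInd_le_one a)), two_mul]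
  exact (abs_sub _ _).trans (add_le_add
    (abs_signedDisc_slice_belowInd_le z hG hG1 K hC hR (ha0.trans hab) hb)
    (abs_signedDisc_slice_belowInd_le z hG hG1 K hC hR ha0 (hab.trans hb)))

/-- The hockey-stick identity. The summand `1` accounts for the remainder of the binary
decomposition. -/
lemma sum_range_choose_sub_add_one (K s : ℕ) :
    ∑ l ∈ Finset.range (K + 1), (K - l + 1 + s).choose s + 1 = (K + 1 + (s + 1)).choose (s + 1) := by
  have h := Nat.sum_range_add_choose (K + 1) s
  rw [Finset.sum_range_succ'] at h
  rw [← add_assoc, ← h, ← Finset.sum_range_reflect (fun l => (l + 1 + s).choose s) (K + 1)]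
  simp

/-- The boxes decompose into few dyadic boxes of volume at least `2 ^ (-h)`, up to a remainder that
is covered by dyadic boxes of volume `2 ^ (-h)`. -/
lemma abs_signedDisc_box_le {h : ℕ} (hn : n ≤ 2 * 2 ^ h) {M : ℝ}
    (hM : ∀ m a : Fin d → ℕ, ∑ i, m i ≤ h → |signedDisc z (haar m a)| ≤ M)
    {a b : Fin d → ℝ} (ha : ∀ i, 0 ≤ a i) (hab : ∀ i, a i ≤ b i) (hb : ∀ i, b i ≤ 1) :
    |signedDisc z (fun x => ∏ i, intervalInd (a i) (b i) (x i))| ≤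
      2 ^ d * ((h + 1 + d).choose d : ℝ) * (M + 4) := by
  have hM0 : 0 ≤ M := (abs_nonneg _).trans (hM 0 0 (by simp))
  have hdy := abs_signedDisc_dyadic_le z hM
  -- The coordinates outside `s` are dyadic and use up part of the total order `h`; `K` is what is
  -- left for those in `s`.
  have key : ∀ s : Finset (Fin d), ∀ (l p : Fin d → ℕ) (K : ℕ), ∑ i ∈ sᶜ, l i + K = h →
      |signedDisc z (fun x => ∏ i, (if i ∈ s then intervalInd (a i) (b i)
        else dyadicInd (l i) (p i)) (x i))| ≤
      2 ^ s.card * ((K + 1 + s.card).choose s.card : ℝ) * (M + 4) := by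
    intro s
    induction s using Finset.induction_on with
    | empty =>
      intro l p K hK
      have := hdy l p (by simp at hK; omega)
      simp only [Finset.notMem_empty, if_false, Finset.card_empty, Nat.choose_zero_right,
        Nat.cast_one, pow_zero, one_mul]
      linarith
    | insert j s hj ih =>
      intro l p K hK
      set G : Fin d → Set.Ico (0 : ℝ) 1 → ℝ := fun i =>
        if i ∈ s then intervalInd (a i) (b i) else dyadicInd (l i) (p i) with hGdef
      have hG : ∀ i, Measurable (G i) := by
        intro i; simp only [hGdef]; split_ifs
        · exact measurable_intervalInd _ _
        · exact measurable_dyadicInd _ _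
      have hG1 : ∀ i x, |G i x| ≤ 1 := by
        intro i; simp only [hGdef]; split_ifs
        · exact abs_intervalInd_le_one _ _
        · exact abs_dyadicInd_le_one _ _
      rw [prod_coord_eq_slice (j := j) (f := intervalInd (a j) (b j)) (G := G)
        (by simp) (fun i hi => by simp [hGdef, hi])]
      have hcompl : sᶜ = insert j (insert j s)ᶜ := by
        ext i
        simp only [Finset.mem_compl, Finset.mem_insert]
        by_cases hi : i = j
        · subst hi; simp [hj]
        · simp [hi]
      have hjc : j ∉ (insert j s)ᶜ := by simp
      have hC : ∀ m ≤ K, ∀ q, |signedDisc z (slice G j (dyadicInd m q))| ≤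
          2 ^ s.card * ((K - m + 1 + s.card).choose s.card : ℝ) * (M + 4) := by
        intro m hm q
        have := ih (Function.update l j m) (Function.update p j q) (K - m) (by
          rw [hcompl, Finset.sum_insert hjc, Function.update_self,
            Finset.sum_congr rfl fun i hi => Function.update_of_ne (by rintro rfl; exact hjc hi) m l]
          omega)
        rwa [prod_coord_eq_slice (j := j) (f := dyadicInd m q) (G := G)
          (by simp [hj]) (fun i hi => by simp [hGdef, hi])] at this
      have hR : ∀ r : Set.Ico (0 : ℝ) 1 → ℝ, ∀ q, (∀ x, |r x| ≤ dyadicInd K q x) →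
          |signedDisc z (slice G j r)| ≤ M + 4 := by
        intro r q hr
        -- The remainder is covered by one dyadic box: coordinate `j` takes all of `K`, and the
        -- coordinates in `s` are enlarged to `[0,1)`, so the total order is exactly `h`.
        let l' : Fin d → ℕ := fun i => if i = j then K else if i ∈ s then 0 else l i
        let p' : Fin d → ℕ := fun i => if i = j then q else if i ∈ s then 0 else p i
        have hsum : ∑ i, l' i = h := by
          rw [← Finset.sum_add_sum_compl s, hcompl, Finset.sum_insert hjc]
          have e1 : ∑ i ∈ s, l' i = 0 := Finset.sum_eq_zero fun i hi => by
            have : i ≠ j := by rintro rfl; exact hj hi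
            simp [l', this, hi]
          have e2 : ∑ i ∈ (insert j s)ᶜ, l' i = ∑ i ∈ (insert j s)ᶜ, l i :=
            Finset.sum_congr rfl fun i hi => by
              simp only [Finset.mem_compl, Finset.mem_insert, not_or] at hi
              simp [l', hi.1, hi.2]
          have e3 : l' j = K := by simp [l']
          rw [e1, e2, e3]; omega
        have hint : Integrable (fun x : UnitCube d => ∏ i, dyadicInd (l' i) (p' i) (x i))
            (lebesgueCube d) :=
          integrable_of_abs_le_one (measurable_prod_coord (fun i => measurable_dyadicInd _ _) _)
            (abs_prod_coord_le_one (fun i => abs_dyadicInd_le_one _ _) _)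
        have hle : ∀ x, |slice G j r x| ≤ ∏ i, dyadicInd (l' i) (p' i) (x i) := by
          intro x
          rw [← Finset.mul_prod_erase _ _ (Finset.mem_univ j), slice, abs_mul, Finset.abs_prod]
          refine mul_le_mul ?_ (Finset.prod_le_prod (fun _ _ => abs_nonneg _) fun i hi => ?_)
            (Finset.prod_nonneg fun _ _ => abs_nonneg _) (dyadicInd_nonneg _ _ _)
          · simpa [l', p'] using hr (x j)
          · have hij := Finset.ne_of_mem_erase hi
            by_cases his : i ∈ s
            · simp only [l', p', hij, his, if_true, if_false, dyadicInd_zero_zero]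
              exact hG1 i _
            · simp only [l', p', hij, his, if_false, hGdef]
              exact (abs_of_nonneg (dyadicInd_nonneg _ _ _)).le
        have hI : ∫ x, ∏ i, dyadicInd (l' i) (p' i) (x i) ∂lebesgueCube d ≤ ((2 : ℝ) ^ h)⁻¹ := by
          rw [integral_prod_coord fun i => dyadicInd (l' i) (p' i)]
          refine (Finset.prod_le_prod (fun i _ => integral_nonneg fun x => dyadicInd_nonneg _ _ _)
            fun i _ => integral_dyadicInd_le (l' i) (p' i)).trans_eq ?_
          rw [Finset.prod_inv_distrib, Finset.prod_pow_eq_pow_sum, hsum]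
        have hn' : (n : ℝ) ≤ 2 * 2 ^ h := by exact_mod_cast hn
        -- The covering box has expected count at most `2`; counted twice in `abs_signedDisc_le`, it
        -- gives the `4` in `M + 4`.
        have h2 : (n : ℝ) * ∫ x, ∏ i, dyadicInd (l' i) (p' i) (x i) ∂lebesgueCube d ≤ 2 := by
          calc _ ≤ (2 * 2 ^ h) * ((2 : ℝ) ^ h)⁻¹ := mul_le_mul hn' hI
                (integral_nonneg fun x => Finset.prod_nonneg fun i _ => dyadicInd_nonneg _ _ _)
                (by positivity)
            _ = 2 := by field_simp
        have h3 := abs_signedDisc_le z hint hle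
        have h4 := hdy l' p' hsum.le
        linarith
      refine (abs_signedDisc_slice_intervalInd_le z hG hG1 K hC hR (ha j) (hab j) (hb j)).trans ?_
      rw [Finset.card_insert_of_notMem hj, ← sum_range_choose_sub_add_one, ← Finset.sum_mul,
        ← Finset.mul_sum]
      push_cast
      set S := ∑ l ∈ Finset.range (K + 1), ((K - l + 1 + s.card).choose s.card : ℝ)
      have h2 : (1 : ℝ) ≤ 2 ^ s.card := one_le_pow₀ (by norm_num)
      rw [pow_succ]
      nlinarith
  simpa using key Finset.univ 0 0 h (by simp)

/-- A bound for the Haar sums up to order `log₂ n` bounds the discrepancy. -/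
lemma boxDisc_le_of_haar_le (Z : ℕ → UnitCube d) {N : ℕ} {M : ℝ} (hM0 : 0 ≤ M)
    (hM : ∀ m ∈ haarOrders d (Nat.log 2 N), ∀ a ∈ haarPositions m,
      |∑ i : Fin N, haar m a (Z i)| ≤ M) :
    boxDisc Z N ≤ 2 ^ d * ((Nat.log 2 N + 1 + d).choose d : ℝ) * (M + 4) := by
  set z : Fin N → UnitCube d := fun i => Z i with hz
  -- Order `0` gives the constant function, whose signed discrepancy is `0`; functions at positions
  -- outside `haarPositions` vanish.
  have hM' : ∀ m a : Fin d → ℕ, ∑ i, m i ≤ Nat.log 2 N → |signedDisc z (haar m a)| ≤ M := by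
    intro m a hm
    by_cases ha : a ∈ haarPositions m
    · rcases Nat.eq_zero_or_pos (∑ i, m i) with h0 | h0
      · have hm0 : m = 0 := by
          funext i
          exact (Finset.sum_eq_zero_iff.mp h0) i (Finset.mem_univ i)
        subst hm0
        have ha0 : a = 0 := by
          funext i
          simpa [haarPositions] using Fintype.mem_piFinset.mp ha i
        subst ha0
        have : haar (0 : Fin d → ℕ) 0 = fun _ => 1 := by
          funext x; simp [haar, haarOne_zero_zero]
        rw [this]
        simpa [signedDisc] using hM0
      · rw [signedDisc, integral_haar h0, mul_zero, sub_zero]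
        exact hM m (mem_haarOrders.mpr ⟨h0, hm⟩) a ha
    · have : haar m a = fun _ => 0 := funext fun x => haar_eq_zero_of_notMem ha x
      rw [this]
      simpa [signedDisc] using hM0
  have hN : N ≤ 2 * 2 ^ Nat.log 2 N := by
    rw [← pow_succ']; exact (Nat.lt_pow_succ_log_self (by norm_num) N).le
  unfold boxDisc discrepancy
  refine Real.sSup_le ?_ (by positivity)
  rintro _ ⟨A, ⟨a, b, hab, rfl⟩, rfl⟩
  have hind : (Set.indicator {x : UnitCube d | ∀ j, a j ≤ (x j : ℝ) ∧ (x j : ℝ) < b j}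
      (fun _ => (1 : ℝ))) = fun x => ∏ i, intervalInd (a i) (b i) (x i) := by
    funext x
    simp only [intervalInd_eq (hab _).2.1.le]
    rw [Fintype.prod_boole]
    simp only [Set.indicator_apply, Set.mem_ofPred_eq]
    congr
  have hmeas : MeasurableSet {x : UnitCube d | ∀ j, a j ≤ (x j : ℝ) ∧ (x j : ℝ) < b j} := by
    rw [Set.ofPred_forall]
    refine MeasurableSet.iInter fun j => ?_
    have hj : Measurable fun x : UnitCube d => (x j : ℝ) :=
      measurable_subtype_coe.comp (measurable_pi_apply j)
    exact (measurableSet_le measurable_const hj).inter (measurableSet_lt hj measurable_const)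
  have hreal : (lebesgueCube d).real {x : UnitCube d | ∀ j, a j ≤ (x j : ℝ) ∧ (x j : ℝ) < b j} =
      ∫ x, ∏ i, intervalInd (a i) (b i) (x i) ∂lebesgueCube d := by
    rw [← hind, integral_indicator hmeas]; simp
  have := abs_signedDisc_box_le z hN hM' (fun i => (hab i).1) (fun i => (hab i).2.1.le)
    (fun i => (hab i).2.2)
  simp only [hind, hreal]
  exact this

end Discrepancy

/-! ### Tail bounds and the limit superior -/

section Tail
variable {d : ℕ}

lemma card_haarOrders_le_pow {n : ℕ} (hn : n ≠ 0) : (haarOrders d (Nat.log 2 n)).card ≤ n ^ d := by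
  refine (Finset.card_filter_le _ _).trans ?_
  rw [Fintype.card_piFinset_const, Finset.card_range]
  exact Nat.pow_le_pow_left (Nat.log_lt_self 2 hn) d

lemma card_haarPositions_le {n : ℕ} (hn : n ≠ 0) {m : Fin d → ℕ}
    (hm : m ∈ haarOrders d (Nat.log 2 n)) : (haarPositions m).card ≤ n := by
  rw [haarPositions, Fintype.card_piFinset]
  simp only [Finset.card_range]
  rw [Finset.prod_pow_eq_pow_sum]
  calc 2 ^ (∑ i, (m i - 1)) ≤ 2 ^ Nat.log 2 n := Nat.pow_le_pow_right (by norm_num)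
        ((Finset.sum_le_sum fun i _ => Nat.sub_le _ _).trans (mem_haarOrders.mp hm).2)
    _ ≤ n := Nat.pow_log_le_self 2 hn

variable {Ω : Type*} [MeasurableSpace Ω] {μ : Measure Ω}

lemma measure_lt_abs_le_of_lintegral_cosh_le {S : Ω → ℝ} {η t K : ℝ} (hη : 0 ≤ η)
    (hS : Measurable S) (h : ∫⁻ ω, ENNReal.ofReal (Real.cosh (η * S ω)) ∂μ ≤ ENNReal.ofReal K) :
    μ {ω | t < |S ω|} ≤ ENNReal.ofReal (2 * K * Real.exp (-(η * t))) := by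
  have hsub : {ω | t < |S ω|} ⊆
      {ω | ENNReal.ofReal (Real.exp (η * t) / 2) ≤ ENNReal.ofReal (Real.cosh (η * S ω))} := by
    intro ω hω
    refine ENNReal.ofReal_le_ofReal ?_
    rw [← Real.cosh_abs, abs_mul, abs_of_nonneg hη, Real.cosh_eq]
    have h1 : Real.exp (η * t) ≤ Real.exp (η * |S ω|) :=
      Real.exp_le_exp.mpr (mul_le_mul_of_nonneg_left (le_of_lt hω) hη)
    have := Real.exp_pos (-(η * |S ω|))
    linarith
  have hm := meas_ge_le_lintegral_div (μ := μ)
    (f := fun ω => ENNReal.ofReal (Real.cosh (η * S ω)))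
    (Real.measurable_cosh.comp (hS.const_mul η)).ennreal_ofReal.aemeasurable
    (ε := ENNReal.ofReal (Real.exp (η * t) / 2)) (by simp [Real.exp_pos]) ENNReal.ofReal_ne_top
  refine (measure_mono hsub).trans (hm.trans ((ENNReal.div_le_div_right h _).trans_eq ?_))
  rw [← ENNReal.ofReal_div_of_pos (by positivity), Real.exp_neg]
  congr 1
  field_simp

variable [IsProbabilityMeasure μ] {X : ℕ → Ω → UnitCube d} {U : ℕ → Ω → ℝ}

/-- Almost surely, all Haar sums of controlled order are eventually of logarithmic size. -/
lemma ae_eventually_haar_le (hd : 1 ≤ d) {β : ℝ} (hβ0 : 0 < β) (hβ1 : β ≤ 1)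
    (hXmeas : ∀ n, Measurable (X n)) (hUmeas : ∀ n, Measurable (U n))
    (hXlaw : ∀ n, μ.map (X n) = lebesgueCube d)
    (hUlaw : ∀ n, μ.map (U n) = volume.restrict (Set.Icc (0 : ℝ) 1))
    (hXindep : iIndepFun X μ) (hUindep : iIndepFun U μ)
    (hXU : IndepFun (fun ω n => X n ω) (fun ω n => U n ω) μ) :
    ∀ᵐ ω ∂μ, ∀ᶠ n : ℕ in atTop, ∀ m ∈ haarOrders d (Nat.log 2 n), ∀ a ∈ haarPositions m,
      |∑ i : Fin n, haar m a (thinnedSeq (haarStrategy d β) (fun k => X k ω) (fun k => U k ω) i)| ≤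
        (d + 4) * Real.log n * (2 * haarWeight d (Nat.log 2 n)) / β := by
  have hT := isThinningStrategy_haarStrategy hd hβ0.le hβ1
  set K := Real.exp (2 ^ d)
  set S : ℕ → (Fin d → ℕ) → (Fin d → ℕ) → Ω → ℝ := fun n m a ω =>
    ∑ i, haar m a ((thinningState (haarStrategy d β) (fun n => X n ω) (fun n => U n ω) n).1 i)
    with hS
  have hSm : ∀ n m a, Measurable (S n m a) := by
    intro n m a
    have hst := (measurable_thinningState hT.measurable n).comp
      ((measurable_pi_lambda _ hXmeas).prodMk (measurable_pi_lambda _ hUmeas))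
    exact Finset.measurable_sum _ fun i _ => (measurable_haar m a).comp
      ((measurable_pi_apply i).comp (measurable_fst.comp hst))
  -- The threshold makes `η t = (d + 4) log n`. Of the resulting `n ^ (-(d + 4))`, the order vectors
  -- cost `n ^ d` and the positions `n`, leaving a summable `n ^ (-3)`.
  set t : ℕ → ℝ := fun n => (d + 4) * Real.log n * (2 * haarWeight d (Nat.log 2 n)) / β with ht
  set B : ℕ → Set Ω := fun n => ⋃ m ∈ haarOrders d (Nat.log 2 n), ⋃ a ∈ haarPositions m,
    {ω | t n < |S n m a ω|} with hB
  have hBle : ∀ n, μ (B n) ≤ ENNReal.ofReal (2 * K * (1 / (n : ℝ) ^ 3)) := by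
    intro n
    rcases Nat.eq_zero_or_pos n with rfl | hn
    · have : haarOrders d (Nat.log 2 0) = ∅ := by
        ext m
        rw [mem_haarOrders]
        simp only [Nat.log_zero_right, Finset.notMem_empty, iff_false]
        omega
      simp only [hB, this]
      simp
    have hn' : (0 : ℝ) < n := by exact_mod_cast hn
    have htail : ∀ m ∈ haarOrders d (Nat.log 2 n), ∀ a ∈ haarPositions m,
        μ {ω | t n < |S n m a ω|} ≤ ENNReal.ofReal (2 * K * ((n : ℝ) ^ (d + 4))⁻¹) := by
      intro m hm a ha
      have hW : 1 ≤ haarWeight d (Nat.log 2 n) :=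
        one_le_haarWeight hd ((mem_haarOrders.mp hm).1.trans (mem_haarOrders.mp hm).2)
      have hW' : (1 : ℝ) ≤ haarWeight d (Nat.log 2 n) := by exact_mod_cast hW
      refine (measure_lt_abs_le_of_lintegral_cosh_le (t := t n) (by positivity) (hSm n m a)
        (lintegral_cosh_le hd hβ0.le hβ1 hXmeas hUmeas hXlaw hUlaw hXindep hUindep hXU hm ha)).trans_eq
        ?_
      congr 2
      have : β / (2 * (haarWeight d (Nat.log 2 n) : ℝ)) * t n = (d + 4 : ℕ) * Real.log n := by
        simp only [ht]; push_cast; field_simp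
      rw [this, Real.exp_neg, Real.exp_nat_mul, Real.exp_log hn']
    calc μ (B n) ≤ ∑ m ∈ haarOrders d (Nat.log 2 n), ∑ a ∈ haarPositions m,
          ENNReal.ofReal (2 * K * ((n : ℝ) ^ (d + 4))⁻¹) :=
          (measure_biUnion_finset_le _ _).trans (Finset.sum_le_sum fun m hm =>
            (measure_biUnion_finset_le _ _).trans (Finset.sum_le_sum fun a ha => htail m hm a ha))
      _ ≤ ∑ m ∈ haarOrders d (Nat.log 2 n), (n : ℝ≥0∞) *
          ENNReal.ofReal (2 * K * ((n : ℝ) ^ (d + 4))⁻¹) := by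
          refine Finset.sum_le_sum fun m hm => ?_
          rw [Finset.sum_const, nsmul_eq_mul]
          gcongr
          exact card_haarPositions_le hn.ne' hm
      _ ≤ ((n ^ d : ℕ) : ℝ≥0∞) * ((n : ℝ≥0∞) *
          ENNReal.ofReal (2 * K * ((n : ℝ) ^ (d + 4))⁻¹)) := by
          rw [Finset.sum_const, nsmul_eq_mul]
          gcongr
          exact card_haarOrders_le_pow hn.ne'
      _ = ENNReal.ofReal (2 * K * (1 / (n : ℝ) ^ 3)) := by
          rw [← ENNReal.ofReal_natCast n, ← ENNReal.ofReal_natCast (n ^ d),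
            ← ENNReal.ofReal_mul (by positivity), ← ENNReal.ofReal_mul (by positivity)]
          congr 1
          push_cast
          field_simp
          ring
  have hsum : ∑' n, μ (B n) ≠ ∞ := by
    have hs : Summable fun n : ℕ => 2 * K * (1 / (n : ℝ) ^ 3) :=
      (Real.summable_one_div_nat_pow.mpr (by norm_num)).mul_left _
    exact ne_top_of_le_ne_top hs.tsum_ofReal_ne_top (ENNReal.tsum_le_tsum hBle)
  filter_upwards [ae_eventually_notMem hsum] with ω hω
  filter_upwards [hω] with n hn m hm a ha
  simp only [hB, Set.mem_iUnion, not_exists] at hn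
  have := hn m hm a ha
  simp only [Set.mem_ofPred_eq, not_lt, hS, thinningState_fst_apply] at this
  exact this

end Tail

/-! ### Asymptotics of the bound and conclusion -/

/-- The `d!` in the binomial coefficient absorbs the `2 ^ d` from the two endpoints per coordinate,
so the final constant is only polynomial in `d`. -/
lemma two_pow_le_two_mul_factorial (d : ℕ) : 2 ^ d ≤ 2 * d.factorial := by
  induction d with
  | zero => norm_num
  | succ d ih =>
    rcases Nat.eq_zero_or_pos d with rfl | hd
    · norm_num
    · rw [pow_succ, Nat.factorial_succ]
      nlinarith [Nat.factorial_pos d]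

lemma eventually_discrepancy_bound_le {d : ℕ} (hd : 1 ≤ d) {β : ℝ} (hβ0 : 0 < β) (hβ1 : β ≤ 1) :
    ∀ᶠ n : ℕ in atTop, 2 ^ d * ((Nat.log 2 n + 1 + d).choose d : ℝ) *
        ((d + 4) * Real.log n * (2 * haarWeight d (Nat.log 2 n)) / β + 4) ≤
      100 * ((d : ℝ) ^ 2 + 1) / β * Real.logb 2 n ^ (2 * d + 1) := by
  have hL : Tendsto (fun n : ℕ => Real.logb 2 n) atTop atTop :=
    (Real.tendsto_logb_atTop (by norm_num)).comp tendsto_natCast_atTop_atTop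
  have hratio : ∀ᶠ L : ℝ in atTop, (L + 1 + d) ^ d ≤ 2 * L ^ d := by
    have h1 : Tendsto (fun L : ℝ => (1 + (1 + d) * L⁻¹) ^ d) atTop (nhds ((1 + (1 + d) * 0) ^ d)) :=
      ((tendsto_inv_atTop_zero.const_mul (1 + (d : ℝ))).const_add 1).pow d
    have h2 : ((1 : ℝ) + (1 + d) * 0) ^ d < 2 := by norm_num
    filter_upwards [h1.eventually (eventually_lt_nhds h2), eventually_gt_atTop 0] with L hL1 hL0
    have e : L + 1 + d = (1 + (1 + d) * L⁻¹) * L := by field_simp; ring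
    rw [e, mul_pow]
    gcongr
  filter_upwards [hL.eventually hratio, hL.eventually (eventually_ge_atTop 4),
    eventually_ge_atTop 1] with n h1 h2 hn
  set L := Real.logb 2 n with hLdef
  have hn' : (1 : ℝ) ≤ n := by exact_mod_cast hn
  have hlogL : (Nat.log 2 n : ℝ) ≤ L := Real.natLog_le_logb n 2
  have hlog : Real.log n ≤ L := by
    rw [hLdef, Real.logb, le_div_iff₀ (Real.log_pos (by norm_num))]
    have := Real.log_two_lt_d9
    nlinarith [Real.log_nonneg hn']
  have hlog0 := Real.log_nonneg hn'
  have hfact : (0 : ℝ) < d.factorial := by exact_mod_cast Nat.factorial_pos d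
  have hC : ((Nat.log 2 n + 1 + d).choose d : ℝ) ≤ 2 * L ^ d / d.factorial := by
    refine (Nat.choose_le_pow_div (α := ℝ) d _).trans ?_
    gcongr
    refine le_trans ?_ h1
    push_cast
    gcongr
  have hW : (haarWeight d (Nat.log 2 n) : ℝ) ≤ 2 * L ^ d := by
    have h3 : haarWeight d (Nat.log 2 n) ≤ (Nat.log 2 n + 1 + d).choose d :=
      (haarWeight_le_choose hd _).trans (Nat.choose_le_choose d (by omega))
    calc (haarWeight d (Nat.log 2 n) : ℝ) ≤ ((Nat.log 2 n + 1 + d).choose d : ℝ) := by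
          exact_mod_cast h3
      _ ≤ 2 * L ^ d / d.factorial := hC
      _ ≤ 2 * L ^ d := div_le_self (by positivity) (by exact_mod_cast Nat.factorial_pos d)
  have hfour : 4 ≤ L ^ (d + 1) / β := by
    rw [le_div_iff₀ hβ0]
    have : L ≤ L ^ (d + 1) := le_self_pow₀ (by linarith) (by omega)
    nlinarith
  have h2d : (2 : ℝ) ^ d * (2 * L ^ d / d.factorial) ≤ 4 * L ^ d := by
    have : (2 : ℝ) ^ d ≤ 2 * d.factorial := by exact_mod_cast two_pow_le_two_mul_factorial d
    rw [mul_div_assoc', div_le_iff₀ hfact]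
    nlinarith [show (0 : ℝ) ≤ L ^ d by positivity]
  calc _ ≤ (4 * L ^ d) * ((d + 4) * L * (2 * (2 * L ^ d)) / β + L ^ (d + 1) / β) := by
        refine mul_le_mul ((mul_le_mul_of_nonneg_left hC (by positivity)).trans h2d) ?_
          (by positivity) (by positivity)
        gcongr
    -- Here `16 d + 68 = 4 (4 (d + 4) + 1)`; the last `1` is the additive `4` of the box bound,
    -- absorbed through `hfour`.
    _ = (16 * d + 68) / β * L ^ (2 * d + 1) := by ring
    _ ≤ _ := by
        gcongr
        nlinarith [sq_nonneg ((d : ℝ) - 1)]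

theorem theorem1 (d : ℕ) (hd : 1 ≤ d) (β : ℝ) (hβ0 : 0 < β) (hβ1 : β ≤ 1)
    {Ω : Type*} [MeasurableSpace Ω] (μ : Measure Ω) [IsProbabilityMeasure μ]
    (X : ℕ → Ω → UnitCube d) (U : ℕ → Ω → ℝ)
    (hXmeas : ∀ n, Measurable (X n)) (hUmeas : ∀ n, Measurable (U n))
    (hXlaw : ∀ n, μ.map (X n) = lebesgueCube d)
    (hUlaw : ∀ n, μ.map (U n) = volume.restrict (Set.Icc (0 : ℝ) 1))
    (hXindep : iIndepFun X μ) (hUindep : iIndepFun U μ)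
    (hXU : IndepFun (fun ω n => X n ω) (fun ω n => U n ω) μ) :
    IsThinningStrategy β (haarStrategy d β) ∧
    ∀ᵐ ω ∂μ,
      limsup (fun n : ℕ =>
        ((boxDisc (thinnedSeq (haarStrategy d β) (fun k => X k ω) (fun k => U k ω)) n
          / Real.logb 2 n ^ (2 * d + 1) : ℝ) : EReal)) atTop
      ≤ ((100 * ((d : ℝ) ^ 2 + 1) / β : ℝ) : EReal) := by

  refine ⟨isThinningStrategy_haarStrategy hd hβ0.le hβ1, ?_⟩
  filter_upwards [ae_eventually_haar_le hd hβ0 hβ1 hXmeas hUmeas hXlaw hUlaw hXindep hUindep hXU]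
    with ω hω
  refine limsup_le_of_le (h := ?_)
  filter_upwards [hω, eventually_discrepancy_bound_le hd hβ0 hβ1, eventually_gt_atTop 1]
    with n hn hb hn1
  have hn1' : (1 : ℝ) < n := by exact_mod_cast hn1
  have hL : 0 < Real.logb 2 n := Real.logb_pos (by norm_num) hn1'
  have hlog := Real.log_pos hn1'
  rw [EReal.coe_le_coe_iff, div_le_iff₀ (by positivity)]
  exact (boxDisc_le_of_haar_le _ (by positivity) hn).trans hb
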